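/- Consider randomized comparison-based algorithms on pairwise distinct elements; a comparison counts once for each of the two elements compared. TournamentMinimum($X$) returns the smallest and the second smallest element of $X$: the minimum is found by a balanced knockout tournament, the second smallest as the minimum of the elements that lost directly to it. Comparisons whose outcome is already known are never repeated. SampleMinimum($X$) returns the smallest and the second smallest element of $X$ as follows. If $|X|\le 8$, return TournamentMinimum($X$). Otherwise choose a uniformly random $A\subset X$ with $|A|=\lceil |X|/2\rceil$ and a uniformly random $B\subset A$ with $|B|=\lfloor |X|^{2/3}\rfloor$. Let $(b_1,b_2)$ be the result of SampleMinimum($B$), $D=\{x\in A\setminus B: x<b_2\}$ (each $x \in A\setminus B$ is compared with $b_2$), $(a_1',a_2')$ the result of SampleMinimum($D$), and $(a_1,a_2)$ the two smallest among the sorted pairs $(a_1',a_2')$, $(b_1,b_2)$. Let $C=\{x\in X\setminus A: x<a_2\}$ (each $x \in X\setminus A$ is compared with $a_2$), $(c_1,c_2)$ the result of TournamentMinimum($C$), and return the two smallest among the sorted pairs $(a_1,a_2)$, $(c_1,c_2)$. (A call on fewer than two elements returns all of them.) For integers $\Delta\ge 2$ and $h\ge 0$ let $n=\Delta^h$, and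 let $X$ be a set of $n$ elements placed in any fixed way at the leaves of the complete $\Delta$-ary tree of height $h$. TreeMinimum$_\Delta$ computes, bottom up, a value $m(v)$ for each node $v$: for a leaf its element, and for an internal node with children $u_1,\dots,u_\Delta$ the smallest element returned by SampleMinimum($\{m(u_1),\dots,m(u_\Delta)\}$), with fresh independent randomness at each node. For $e\in X$ let $f_e$ be the (random) number of comparisons in which $e$ participates during the run. **Theorem.** (a) There is an absolute constant $K>0$ such that for all $\Delta\ge2$, $n=\Delta^h$ and all inputs $X$: $\mathbb E[f_e]\le K\log_\Delta n$ if $e=\min X$, and $\mathbb E[f_e]\le \Delta+K\log_\Delta n$ for each other element $e\in X$. (b) For every $c>0$ there is a constant $K>0$, depending only on $c$, such that for all $\Delta\ge 3$, $n=\Delta^h$ and all inputs $X$ (logarithms to base 2): with probability at least $1-n^{-c}$, $$f_{\min X}\le K\,\frac{\log n\cdot\log\log\Delta}{\log\Delta},$$ and with probability at least $1-n^{-c}$, $$f_e\le \Delta+K\,\frac{\log n\cdot\log\log\Delta}{\log\Delta}\qquad\text{for all } e\in X\setminus\{\min X\}\text{ simultaneously}.$$ -/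

import Mathlib

open scoped ENNReal

universe u

/-! ### Randomized comparison-based algorithms

The elements live in a linear order `α`. An algorithm may inspect that order only by comparing two
elements, and every comparison is charged to both of them. -/

/-- A randomized comparison-based computation with result in `β`: the joint law of its result and
of the function that tells, for each element, in how many comparisons it participated. -/
def Comp (α β : Type u) : Type u := PMF (β × (α → ℕ))

namespace Comp

variable {α β : Type u}

/-- Running one computation after the other: fresh randomness, and the comparisons add up. -/
noncomputable instance : Monad (Comp α) where
  pure b := (PMF.pure (b, 0) : PMF _)
  bind P f := PMF.bind P fun r => PMF.map (fun s => (s.1, r.2 + s.2)) (f r.1)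

section Comparisons
variable [LinearOrder α]

/-- The charge for one comparison of `x` with `y`: one for `x` and one for `y`. -/
def tick (x y : α) : α → ℕ := Pi.single x 1 + Pi.single y 1

/-- Compare `x` with `y` (once), then continue with `P` if `x < y` and with `Q` otherwise. -/
noncomputable def ifLess (x y : α) (P Q : Comp α β) : Comp α β :=
  PMF.map (fun s => (s.1, tick x y + s.2)) (if x < y then P else Q)

/-- Compare each element of `S` (once) with `p`, and return those that are smaller than `p`. -/
noncomputable def filterLess (p : α) (S : Finset α) : Comp α {D : Finset α // D ⊆ S} :=
  PMF.pure (⟨S.filter (· < p), Finset.filter_subset _ _⟩, ∑ x ∈ S, tick x p)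

end Comparisons

/-- A uniformly random subset of `S` with exactly `k` elements; no comparisons. -/
noncomputable def sample (S : Finset α) (k : ℕ) (hk : k ≤ S.card) :
    Comp α {T : Finset α // T ∈ S.powersetCard k} :=
  haveI : Nonempty {T : Finset α // T ∈ S.powersetCard k} :=
    (Finset.powersetCard_nonempty.2 hk).to_subtype
  PMF.map (fun T => (T, 0)) (PMF.uniformOfFintype {T : Finset α // T ∈ S.powersetCard k})

/-- The expected number of comparisons in which `e` participates. -/
noncomputable def expectedComparisons (P : Comp α β) (e : α) : ℝ≥0∞ :=
  ∑' r : β × (α → ℕ), (show PMF (β × (α → ℕ)) from P) r * (r.2 e : ℝ≥0∞)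

/-- The probability that the comparison counts satisfy `E`. -/
noncomputable def probComparisons (P : Comp α β) (E : (α → ℕ) → Prop) : ℝ≥0∞ :=
  (show PMF (β × (α → ℕ)) from P).toOuterMeasure {r | E r.2}

end Comp

/-! ### The deterministic tournament -/

section Tournament
variable {α : Type u} [LinearOrder α]

/-- A balanced knockout tournament on the list `l`. It returns the winner (the smallest element),
followed by the elements that lost directly against the winner. -/
noncomputable def knockout (l : List α) : Comp α (List α) :=
  if _h : l.length ≤ 1 then pure l
  else do
    let p ← knockout (l.take (l.length / 2))
    let q ← knockout (l.drop (l.length / 2))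
    match p, q with
    | x :: xs, y :: ys => Comp.ifLess x y (pure (x :: y :: xs)) (pure (y :: x :: ys))
    | _, _ => pure (p ++ q)  -- not reached: both halves are non-empty
termination_by l.length
decreasing_by
  · simp only [List.length_take]; omega
  · simp only [List.length_drop]; omega

/-- TournamentMinimum: the smallest and the second smallest element of `X`, in this order (fewer if
`X` has fewer than two elements). The minimum comes from a balanced tournament (on a fixed but
arbitrary arrangement of `X`), and the second smallest element is the smallest among those that
lost directly against the minimum. -/
noncomputable def tournamentMinimum (X : Finset α) : Comp α (List α) := do
  match ← knockout X.toList with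
  | [] => pure []
  | w :: losers => do
    let s ← knockout losers
    pure (w :: s.take 1)

/-- TournamentMinimum on `p₁, p₂, q₁, q₂` for two pairs that are already sorted, where
`q = [q₁, q₂]` and `p` (which may have fewer than two members) consists of elements already found
to be smaller than `q₂`. It returns the smallest and the second smallest element; comparisons with
an outcome known beforehand (`p₁` with `p₂`, `q₁` with `q₂`, `pᵢ` with `q₂`) are not repeated. -/
noncomputable def combinePairs (p q : List α) : Comp α (List α) :=
  match p, q with
  | [], q => pure q
  | p, [] => pure p  -- not reached: `q` always has two members
  | [p₁], q₁ :: _ => Comp.ifLess p₁ q₁ (pure [p₁, q₁]) (pure [q₁, p₁])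
  | p₁ :: p₂ :: _, q₁ :: _ =>
      Comp.ifLess p₁ q₁
        (Comp.ifLess p₂ q₁ (pure [p₁, p₂]) (pure [p₁, q₁]))
        (pure [q₁, p₁])

/-- Compare every element of `S` with the second member of `q`, and return those that are
smaller. -/
noncomputable def filterSecond (q : List α) (S : Finset α) : Comp α {D : Finset α // D ⊆ S} :=
  match q with
  | _ :: q₂ :: _ => Comp.filterLess q₂ S
  | _ => pure ⟨S, subset_rfl⟩  -- not reached: `q` always has two members

end Tournament

/-! ### SampleMinimum -/

theorem floor_rpow_two_thirds_le {n : ℕ} (hn : 8 < n) :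
    ⌊(n : ℝ) ^ (2 / 3 : ℝ)⌋₊ ≤ (n + 1) / 2 := by
  set m := ⌊(n : ℝ) ^ (2 / 3 : ℝ)⌋₊ with hm
  have h1 : (m : ℝ) ≤ (n : ℝ) ^ (2 / 3 : ℝ) := Nat.floor_le (by positivity)
  have h2 : (m : ℝ) ^ 3 ≤ (n : ℝ) ^ 2 := by
    calc (m : ℝ) ^ 3 ≤ ((n : ℝ) ^ (2 / 3 : ℝ)) ^ 3 := by gcongr
      _ = (n : ℝ) ^ 2 := by
        rw [← Real.rpow_natCast, ← Real.rpow_mul (by positivity)]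
        norm_num
  have h3 : m ^ 3 ≤ n ^ 2 := by exact_mod_cast h2
  by_contra h
  have h4 : n + 1 ≤ 2 * m := by omega
  have h5 : (n + 1) ^ 3 ≤ (2 * m) ^ 3 := Nat.pow_le_pow_left h4 3
  nlinarith [Nat.mul_le_mul_right (n ^ 2) hn.le]

section SampleMinimum
variable {α : Type u} [LinearOrder α]

/-- SampleMinimum: the smallest and the second smallest element of `X`. Here `⌈n / 2⌉` is written
`(n + 1) / 2`, with division of natural numbers. -/
noncomputable def sampleMinimum (X : Finset α) : Comp α (List α) :=
  if h : X.card ≤ 8 then tournamentMinimum X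
  else do
    let A ← Comp.sample X ((X.card + 1) / 2) (by omega)
    let B ← Comp.sample A.1 ⌊(X.card : ℝ) ^ (2 / 3 : ℝ)⌋₊
      ((floor_rpow_two_thirds_le (not_le.1 h)).trans_eq (Finset.mem_powersetCard.1 A.2).2.symm)
    let b ← sampleMinimum B.1
    let D ← filterSecond b (A.1 \ B.1)
    let a' ← sampleMinimum D.1
    let a ← combinePairs a' b
    let C ← filterSecond a (X \ A.1)
    let c ← tournamentMinimum C.1
    combinePairs c a
termination_by X.card
decreasing_by
  · have hA := (Finset.mem_powersetCard.1 A.2).2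
    have hB := Finset.card_le_card (Finset.mem_powersetCard.1 B.2).1
    omega
  · have hA := (Finset.mem_powersetCard.1 A.2).2
    have hD := Finset.card_le_card (D.2.trans Finset.sdiff_subset)
    omega

/-! ### TreeMinimum -/

/-- TreeMinimum with parameter `Δ` on the complete `Δ`-ary tree of height `h`. A leaf is addressed
by the path `Fin h → Fin Δ` from the root, and `x` assigns the input elements to the leaves. The
value `m(v)` of a leaf is its element; the value of an internal node is computed by SampleMinimum
from the values of its `Δ` children. -/
noncomputable def treeMinimum (Δ : ℕ) :
    (h : ℕ) → ((Fin h → Fin Δ) → α) → Comp α (Option α)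
  | 0, x => pure (some (x Fin.elim0))
  | h + 1, x => do
      let m ← (List.finRange Δ).mapM' fun i =>
        treeMinimum Δ h fun path => x (Fin.cons i path)
      let r ← sampleMinimum m.reduceOption.toFinset
      pure r.head?

end SampleMinimum

/-! ### Moment generating functions of comparison counts -/

/-! Everything is read off from the generating function `E[z ^ f_e]`. Whatever the random choices,
each procedure returns the correct values (`Comp.Yields`), so the sets handled at a tree node are
fixed in advance. Counts from successive computations are therefore independent, and generating
functions multiply (`Comp.Yields.mgf_bind`).

In the tree, an element takes part only in the calls on the path from its leaf up to the node where
it first loses. While it wins, each call costs a factor `M`, which bounds the generating function of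
a minimum in SampleMinimum. The call that it loses costs at most `z ^ Δ`, because no element of a
`Δ`-set is ever compared more than `Δ - 1` times. This gives `M ^ h` for the minimum and `z ^ Δ * M
^ h` for the others (`mgf_treeMinimum_le`). The summand `Δ` gets coefficient one because `z ^ Δ`
stands alone.

It remains to bound `M`. The minimum `e` of `X` misses `A` with probability at least 4/9; it then
pays about `log |C|`, where `|C|` has a geometric tail (`card_belowSecond_tail`). If `e ∈ A`, it
pays 4 and recurses into `B` or `D` (`mgf_sampleMinimum_le`, `mgf_sampleMinimum_step`). For `z =
21/20` the factor `5/9 * z ^ 4` is below 1, so `M` is an absolute constant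
(`mgf_sampleMinimum_le_const`); convexity then gives (a).

For (b), `z = 2 ^ p` is large and the geometric decay no longer suffices. But `B` and, outside an
event of probability `2 * exp (-5p)`, also `D` have at most `|X| ^ (2/3)` elements. So about `log
log Δ` rounds, each costing a factor `z ^ 6`, lead to sets of size `O(p ^ 3)`, where the worst case
bound is good enough (`mgf_sampleMinimum_le_growth`). With `p` about `log Δ / log log Δ` the result
is polynomial in `Δ` (`exists_mgfBase_le`), and Markov's inequality with a union bound over the
leaves finishes. -/

theorem PMF.tsum_pure_mul {β : Type*} (b : β) (φ : β → ℝ≥0∞) :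
    ∑' r, PMF.pure b r * φ r = φ b := by
  rw [tsum_eq_single b]
  · simp
  · intro r hr
    simp [PMF.pure_apply, hr]

theorem PMF.tsum_bind_mul {β γ : Type*} (p : PMF β) (f : β → PMF γ) (φ : γ → ℝ≥0∞) :
    ∑' r, p.bind f r * φ r = ∑' b, p b * ∑' r, f b r * φ r := by
  simp_rw [PMF.bind_apply, ← ENNReal.tsum_mul_right, ← ENNReal.tsum_mul_left]
  rw [ENNReal.tsum_comm]
  simp_rw [mul_assoc]

theorem PMF.tsum_map_mul {β γ : Type*} (p : PMF β) (g : β → γ) (φ : γ → ℝ≥0∞) :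
    ∑' r, p.map g r * φ r = ∑' b, p b * φ (g b) := by
  simp only [PMF.map, PMF.tsum_bind_mul, Function.comp_apply, PMF.tsum_pure_mul]

namespace Comp
variable {α β γ : Type u}

/-- The joint law of the result and the comparison counts. -/
def law (P : Comp α β) : PMF (β × (α → ℕ)) := P

theorem law_pure (b : β) : law (pure b : Comp α β) = PMF.pure (b, 0) := rfl

theorem law_bind (P : Comp α β) (f : β → Comp α γ) :
    law (P >>= f) = (law P).bind fun r => (law (f r.1)).map fun s => (s.1, r.2 + s.2) := rfl

/-- The moment generating function of the number of comparisons of `e`, in the form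
`E[z ^ count]`. -/
noncomputable def mgf (P : Comp α β) (z : ℝ≥0∞) (e : α) : ℝ≥0∞ :=
  ∑' r : β × (α → ℕ), law P r * z ^ r.2 e

/-- Every run of `P` returns `v` and uses at most `κ e` comparisons of each element `e`. -/
def Yields (P : Comp α β) (v : β) (κ : α → ℕ) : Prop :=
  ∀ r ∈ (law P).support, r.1 = v ∧ r.2 ≤ κ

theorem Yields.mono {P : Comp α β} {v : β} {κ κ' : α → ℕ} (h : Yields P v κ) (hκ : κ ≤ κ') :
    Yields P v κ' := fun r hr => ⟨(h r hr).1, (h r hr).2.trans hκ⟩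

theorem yields_pure (b : β) : Yields (pure b : Comp α β) b 0 := by
  intro r hr
  rw [law_pure, PMF.support_pure, Set.mem_singleton_iff] at hr
  simp [hr]

theorem Yields.bind {P : Comp α β} {f : β → Comp α γ} {v : β} {w : γ} {κ κ' : α → ℕ}
    (h : Yields P v κ) (h' : Yields (f v) w κ') : Yields (P >>= f) w (κ + κ') := by
  intro r hr
  rw [law_bind, PMF.mem_support_bind_iff] at hr
  obtain ⟨s, hs, hr⟩ := hr
  rw [PMF.mem_support_map_iff] at hr
  obtain ⟨t, ht, rfl⟩ := hr
  rw [(h s hs).1] at ht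
  exact ⟨(h' t ht).1, add_le_add (h s hs).2 (h' t ht).2⟩

theorem mgf_pure (b : β) (z : ℝ≥0∞) (e : α) : mgf (pure b : Comp α β) z e = 1 := by
  rw [mgf, law_pure, PMF.tsum_pure_mul]
  simp

theorem mgf_bind_eq_tsum (P : Comp α β) (f : β → Comp α γ) (z : ℝ≥0∞) (e : α) :
    mgf (P >>= f) z e = ∑' r, law P r * (z ^ r.2 e * mgf (f r.1) z e) := by
  rw [mgf, law_bind, PMF.tsum_bind_mul]
  congr! 3 with r
  rw [PMF.tsum_map_mul, mgf, ← ENNReal.tsum_mul_left]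
  congr! 2 with s
  change _ * z ^ (r.2 e + s.2 e) = _
  rw [pow_add]
  ring

/-- Since the intermediate value is the same in every run, the continuation is one fixed computation
with fresh randomness, independent of the counts so far. -/
theorem Yields.mgf_bind {P : Comp α β} {f : β → Comp α γ} {v : β} {κ : α → ℕ}
    (h : Yields P v κ) (z : ℝ≥0∞) (e : α) :
    mgf (P >>= f) z e = mgf P z e * mgf (f v) z e := by
  rw [mgf_bind_eq_tsum, mgf, ← ENNReal.tsum_mul_right]
  congr! 2 with r
  by_cases hr : r ∈ (law P).support
  · rw [(h r hr).1, mul_assoc]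
  · simp [(PMF.apply_eq_zero_iff _ _).2 hr]

theorem Yields.mgf_le {P : Comp α β} {v : β} {κ : α → ℕ} (h : Yields P v κ) {z : ℝ≥0∞}
    (hz : 1 ≤ z) (e : α) : mgf P z e ≤ z ^ κ e := by
  calc mgf P z e ≤ ∑' r, law P r * z ^ κ e := by
        refine ENNReal.tsum_le_tsum fun r => ?_
        by_cases hr : r ∈ (law P).support
        · exact mul_le_mul_right (pow_le_pow_right₀ hz ((h r hr).2 e)) _
        · simp [(PMF.apply_eq_zero_iff _ _).2 hr]
    _ = z ^ κ e := by rw [ENNReal.tsum_mul_right, PMF.tsum_coe, one_mul]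

/-- The average of `g` over the members of `𝒜`. -/
noncomputable def mean {ι : Type*} (𝒜 : Finset ι) (g : ι → ℝ≥0∞) : ℝ≥0∞ :=
  (𝒜.card : ℝ≥0∞)⁻¹ * ∑ T ∈ 𝒜, g T

theorem mean_mono {ι : Type*} {𝒜 : Finset ι} {g g' : ι → ℝ≥0∞} (h : ∀ T ∈ 𝒜, g T ≤ g' T) :
    mean 𝒜 g ≤ mean 𝒜 g' :=
  mul_le_mul_right (Finset.sum_le_sum h) _

/-- Passage from averages in `ℝ≥0∞` to sums of reals, where the counting estimates live. -/
theorem mean_le_ofReal {ι : Type*} {𝒜 : Finset ι} {g : ι → ℝ≥0∞} {g' : ι → ℝ} {c : ℝ}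
    (h𝒜 : 𝒜.Nonempty) (h : ∀ T ∈ 𝒜, g T ≤ ENNReal.ofReal (g' T)) (h0 : ∀ T ∈ 𝒜, 0 ≤ g' T)
    (hc : ∑ T ∈ 𝒜, g' T ≤ c * 𝒜.card) : mean 𝒜 g ≤ ENNReal.ofReal c := by
  have h1 : (0 : ℝ) < 𝒜.card := by exact_mod_cast h𝒜.card_pos
  calc mean 𝒜 g ≤ (𝒜.card : ℝ≥0∞)⁻¹ * ENNReal.ofReal (c * 𝒜.card) := by
        refine mul_le_mul_right ((Finset.sum_le_sum h).trans ?_) _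
        rw [← ENNReal.ofReal_sum_of_nonneg h0]
        exact ENNReal.ofReal_le_ofReal hc
    _ = ENNReal.ofReal c := by
        rw [mul_comm c, ENNReal.ofReal_mul h1.le, ENNReal.ofReal_natCast, ← mul_assoc,
          ENNReal.inv_mul_cancel (by exact_mod_cast h1.ne') (ENNReal.natCast_ne_top _), one_mul]

/-! ### Computations that start with a uniform sample -/

section Sample
variable {S : Finset α} {k : ℕ} {hk : k ≤ S.card}
  {f : {T : Finset α // T ∈ S.powersetCard k} → Comp α β}

theorem yields_sample_bind {v : β} {κ : α → ℕ} (h : ∀ T, Yields (f T) v κ) :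
    Yields (sample S k hk >>= f) v κ := by
  intro r hr
  rw [law_bind, PMF.mem_support_bind_iff] at hr
  obtain ⟨s, hs, hr⟩ := hr
  rw [PMF.mem_support_map_iff] at hr
  obtain ⟨t, ht, rfl⟩ := hr
  have : Nonempty {T : Finset α // T ∈ S.powersetCard k} :=
    (Finset.powersetCard_nonempty.2 hk).to_subtype
  have hs' : s ∈ (PMF.map (fun T => (T, (0 : α → ℕ)))
    (PMF.uniformOfFintype {T : Finset α // T ∈ S.powersetCard k})).support := hs
  rw [PMF.mem_support_map_iff] at hs'
  obtain ⟨T, -, rfl⟩ := hs'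
  simpa using h _ t ht

theorem mgf_sample_bind_le {z : ℝ≥0∞} {e : α} {g : Finset α → ℝ≥0∞}
    (h : ∀ T, mgf (f T) z e ≤ g T.1) :
    mgf (sample S k hk >>= f) z e ≤ mean (S.powersetCard k) g := by
  have : Nonempty {T : Finset α // T ∈ S.powersetCard k} :=
    (Finset.powersetCard_nonempty.2 hk).to_subtype
  have h1 : law (sample S k hk) = PMF.map (fun T => (T, (0 : α → ℕ)))
    (PMF.uniformOfFintype {T : Finset α // T ∈ S.powersetCard k}) := rfl
  rw [mgf_bind_eq_tsum, h1, PMF.tsum_map_mul, tsum_fintype]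
  simp only [PMF.uniformOfFintype_apply, Pi.zero_apply, pow_zero, one_mul]
  rw [← Finset.mul_sum, mean, Fintype.card_coe,
    ← Finset.sum_coe_sort (S.powersetCard k) g]
  exact mul_le_mul_right (Finset.sum_le_sum fun T _ => h T) _

end Sample

/-! ### Elementary comparison steps -/

section Comparisons
variable [LinearOrder α]

theorem law_ifLess (x y : α) (P Q : Comp α β) : law (ifLess x y P Q) =
    (law (if x < y then P else Q)).map fun s => (s.1, tick x y + s.2) := rfl

theorem Yields.ifLess_of_lt {x y : α} (hxy : x < y) {P Q : Comp α β} {v : β} {κ : α → ℕ}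
    (h : Yields P v κ) : Yields (ifLess x y P Q) v (tick x y + κ) := by
  intro r hr
  rw [law_ifLess, if_pos hxy] at hr
  rw [PMF.mem_support_map_iff] at hr
  obtain ⟨t, ht, rfl⟩ := hr
  exact ⟨(h t ht).1, add_le_add le_rfl (h t ht).2⟩

theorem Yields.ifLess_of_not_lt {x y : α} (hxy : ¬ x < y) {P Q : Comp α β} {v : β} {κ : α → ℕ}
    (h : Yields Q v κ) : Yields (ifLess x y P Q) v (tick x y + κ) := by
  intro r hr
  rw [law_ifLess, if_neg hxy] at hr
  rw [PMF.mem_support_map_iff] at hr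
  obtain ⟨t, ht, rfl⟩ := hr
  exact ⟨(h t ht).1, add_le_add le_rfl (h t ht).2⟩

theorem yields_filterLess (p : α) (S : Finset α) :
    Yields (filterLess p S) ⟨S.filter (· < p), Finset.filter_subset _ _⟩ (∑ x ∈ S, tick x p) := by
  intro r hr
  change r ∈ (PMF.pure _).support at hr
  rw [PMF.support_pure, Set.mem_singleton_iff] at hr
  simp [hr]

end Comparisons
end Comp

/-! ### The tournament -/

/-! ### The two smallest elements of a finite set -/

section TwoMin
variable {α : Type u} [LinearOrder α]

/-- The smallest and the second smallest element of `X` (fewer if `X` is smaller). -/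
noncomputable def twoMin (X : Finset α) : List α := (X.sort (· ≤ ·)).take 2

@[simp] theorem twoMin_empty : twoMin (∅ : Finset α) = [] := by simp [twoMin]

@[simp] theorem twoMin_singleton (a : α) : twoMin {a} = [a] := by simp [twoMin]

/-- `a` and `b` are the smallest and the second smallest element of `X`. -/
structure IsTwoMin (X : Finset α) (a b : α) : Prop where
  fst_mem : a ∈ X
  snd_mem : b ∈ X
  lt : a < b
  le : ∀ x ∈ X, x ≠ a → b ≤ x

theorem IsTwoMin.fst_le {X : Finset α} {a b : α} (h : IsTwoMin X a b) {x : α} (hx : x ∈ X) :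
    a ≤ x := by
  by_cases hxa : x = a
  · exact hxa.ge
  · exact h.lt.le.trans (h.le x hx hxa)

theorem IsTwoMin.twoMin_eq {X : Finset α} {a b : α} (h : IsTwoMin X a b) :
    twoMin X = [a, b] := by
  have hb : b ∈ X.erase a := Finset.mem_erase.2 ⟨h.lt.ne', h.snd_mem⟩
  rw [twoMin, ← Finset.insert_erase h.fst_mem, Finset.sort_insert (· ≤ ·) _ (by simp),
    ← Finset.insert_erase hb, Finset.sort_insert (· ≤ ·) _ (by simp)]
  · simp
  · intro x hx
    simp only [Finset.mem_erase] at hx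
    exact h.le x hx.2.2 hx.2.1
  · intro x hx
    exact h.fst_le (Finset.mem_of_mem_erase hx)

theorem exists_isTwoMin {X : Finset α} (h : 2 ≤ X.card) : ∃ a b, IsTwoMin X a b := by
  have h1 : X.Nonempty := Finset.card_pos.1 (by omega)
  have h2 : (X.erase (X.min' h1)).Nonempty := by
    rw [← Finset.card_pos, Finset.card_erase_of_mem (X.min'_mem h1)]
    omega
  have h3 := Finset.min'_mem _ h2
  rw [Finset.mem_erase] at h3
  exact ⟨X.min' h1, (X.erase (X.min' h1)).min' h2, X.min'_mem h1, h3.2,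
    lt_of_le_of_ne (X.min'_le _ h3.2) h3.1.symm,
    fun x hx hxa => Finset.min'_le _ _ (Finset.mem_erase.2 ⟨hxa, hx⟩)⟩

end TwoMin

section Tournament
variable {α : Type u} [LinearOrder α]

theorem Comp.tick_apply (x y e : α) :
    Comp.tick x y e = (if e = x then 1 else 0) + (if e = y then 1 else 0) := by
  simp [Comp.tick, Pi.single_apply]

/-- The outcome of a knockout tournament on `S` with winner `w`, direct losers `ls` and
comparison counts `κ`. -/
structure IsKnockout (S : Finset α) (w : α) (ls : List α) (κ : α → ℕ) : Prop where
  mem : w ∈ S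
  le : ∀ x ∈ S, w ≤ x
  nodup : (w :: ls).Nodup
  sub : ∀ x ∈ ls, x ∈ S
  cover : ∀ x ∈ S, x ≠ w → ∃ y ∈ ls, y ≤ x
  win : κ w = ls.length
  clog : κ w ≤ Nat.clog 2 S.card
  lose : ∀ e ∈ ls, κ e + ls.length ≤ S.card
  all : ∀ e ∈ S, κ e + 1 ≤ S.card
  out : ∀ e ∉ S, κ e = 0

theorem isKnockout_singleton (a : α) : IsKnockout {a} a [] 0 := by
  constructor <;> simp

theorem IsKnockout.length_lt {S : Finset α} {w : α} {ls : List α} {κ : α → ℕ}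
    (h : IsKnockout S w ls κ) : ls.length < S.card := by
  have := h.all w h.mem
  rw [h.win] at this
  omega

/-- Only the two winners `x` and `y` receive a new comparison. The field `lose` is kept for the new
loser `y` because both lists of losers are shorter than their sets; for the old losers the list
grows by one, and so does the set, at least. -/
theorem IsKnockout.merge {S T : Finset α} {x y : α} {xs ys : List α} {κ κ' : α → ℕ}
    (h : IsKnockout S x xs κ) (h' : IsKnockout T y ys κ') (hST : Disjoint S T) (hxy : x < y)
    (hc : Nat.clog 2 S.card + 1 ≤ Nat.clog 2 (S ∪ T).card) :
    IsKnockout (S ∪ T) x (y :: xs) (κ + κ' + Comp.tick x y) := by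
  have hcard := Finset.card_union_of_disjoint hST
  have hT : 1 ≤ T.card := Finset.card_pos.2 ⟨y, h'.mem⟩
  have hyS : y ∉ S := Finset.disjoint_right.1 hST h'.mem
  have hxT : x ∉ T := Finset.disjoint_left.1 hST h.mem
  have hnd := List.nodup_cons.1 h.nodup
  have hlen := h.length_lt
  have hlen' := h'.length_lt
  have hx : (κ + κ' + Comp.tick x y) x = xs.length + 1 := by
    simp [Comp.tick_apply, h.win, h'.out x hxT, hxy.ne]
  have hy : (κ + κ' + Comp.tick x y) y = ys.length + 1 := by
    simp [Comp.tick_apply, h'.win, h.out y hyS, hxy.ne']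
  have hS : ∀ e ∈ S, e ≠ x → (κ + κ' + Comp.tick x y) e = κ e := by
    intro e he hex
    have hey : e ≠ y := fun h => hyS (h ▸ he)
    simp [Comp.tick_apply, h'.out e (Finset.disjoint_left.1 hST he), hex, hey]
  have hT' : ∀ e ∈ T, e ≠ y → (κ + κ' + Comp.tick x y) e = κ' e := by
    intro e he hey
    have hex : e ≠ x := fun h => hxT (h ▸ he)
    simp [Comp.tick_apply, h.out e (Finset.disjoint_right.1 hST he), hex, hey]
  constructor
  · exact Finset.mem_union_left _ h.mem
  · intro e he
    rcases Finset.mem_union.1 he with he | he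
    · exact h.le e he
    · exact hxy.le.trans (h'.le e he)
  · refine List.nodup_cons.2 ⟨?_, List.nodup_cons.2 ⟨fun hy => hyS (h.sub y hy), hnd.2⟩⟩
    rw [List.mem_cons, not_or]
    exact ⟨hxy.ne, hnd.1⟩
  · intro e he
    rcases List.mem_cons.1 he with rfl | he
    · exact Finset.mem_union_right _ h'.mem
    · exact Finset.mem_union_left _ (h.sub e he)
  · intro e he hex
    rcases Finset.mem_union.1 he with he | he
    · obtain ⟨z, hz, hze⟩ := h.cover e he hex
      exact ⟨z, List.mem_cons_of_mem _ hz, hze⟩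
    · exact ⟨y, List.mem_cons_self, h'.le e he⟩
  · rw [hx, List.length_cons]
  · rw [hx, ← h.win]
    exact (Nat.succ_le_succ h.clog).trans hc
  · intro e he
    rw [List.length_cons]
    rcases List.mem_cons.1 he with rfl | he
    · omega
    · have := h.lose e he
      rw [hS e (h.sub e he) fun hex => hnd.1 (hex ▸ he)]
      omega
  · intro e he
    rcases Finset.mem_union.1 he with he | he
    · by_cases hex : e = x
      · subst hex; omega
      · have := h.all e he
        rw [hS e he hex]; omega
    · by_cases hey : e = y
      · subst hey; have : 1 ≤ S.card := Finset.card_pos.2 ⟨x, h.mem⟩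
        omega
      · have := h'.all e he
        rw [hT' e he hey]; omega
  · intro e he
    rw [Finset.mem_union, not_or] at he
    have hex : e ≠ x := fun hx => he.1 (hx ▸ h.mem)
    have hey : e ≠ y := fun hy => he.2 (hy ▸ h'.mem)
    simp [Comp.tick_apply, h.out e he.1, h'.out e he.2, hex, hey]

theorem clog_two_add_one_le {a n : ℕ} (hn : 2 ≤ n) (ha : a ≤ (n + 1) / 2) :
    Nat.clog 2 a + 1 ≤ Nat.clog 2 n := by
  rw [Nat.clog_of_one_lt (by norm_num) (by omega : 1 < n)]
  have := Nat.clog_mono_right 2 ha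
  simpa using this

theorem exists_knockout : ∀ (l : List α), l.Nodup → l ≠ [] → ∃ w ls κ,
    (knockout l).Yields (w :: ls) κ ∧ IsKnockout l.toFinset w ls κ
  | l, hl, hne => by
    by_cases h1 : l.length ≤ 1
    · obtain ⟨a, rfl⟩ : ∃ a, l = [a] := by
        rw [← List.length_eq_one_iff]
        have := List.length_pos_iff.2 hne
        omega
      refine ⟨a, [], 0, ?_, by simpa using isKnockout_singleton a⟩
      rw [knockout, dif_pos h1]
      exact Comp.yields_pure _
    · have hcut : l.take (l.length / 2) ++ l.drop (l.length / 2) = l := List.take_append_drop _ _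
      have hlt : (l.take (l.length / 2)).length < l.length := by
        simp only [List.length_take]; omega
      have hld : (l.drop (l.length / 2)).length < l.length := by
        simp only [List.length_drop]; omega
      have hnd := hl
      rw [← hcut, List.nodup_append'] at hnd
      obtain ⟨x, xs, κ, hx, hX⟩ := exists_knockout (l.take (l.length / 2)) hnd.1 (by
        rw [← List.length_pos_iff, List.length_take]; omega)
      obtain ⟨y, ys, κ', hy, hY⟩ := exists_knockout (l.drop (l.length / 2)) hnd.2.1 (by
        rw [← List.length_pos_iff, List.length_drop]; omega)
      have hdis : Disjoint (l.take (l.length / 2)).toFinset (l.drop (l.length / 2)).toFinset := by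
        rw [List.disjoint_toFinset_iff_disjoint]
        exact hnd.2.2
      have hun : l.toFinset =
          (l.take (l.length / 2)).toFinset ∪ (l.drop (l.length / 2)).toFinset := by
        rw [← List.toFinset_append, hcut]
      have hcard : (l.toFinset).card = l.length := List.toFinset_card_of_nodup hl
      have hcX : (l.take (l.length / 2)).toFinset.card = l.length / 2 := by
        rw [List.toFinset_card_of_nodup hnd.1, List.length_take]; omega
      have hcY : (l.drop (l.length / 2)).toFinset.card = l.length - l.length / 2 := by
        rw [List.toFinset_card_of_nodup hnd.2.1, List.length_drop]
      by_cases hxy : x < y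
      · refine ⟨x, y :: xs, κ + (κ' + (Comp.tick x y + 0)), ?_, ?_⟩
        · rw [knockout, dif_neg h1]
          exact hx.bind (hy.bind (Comp.Yields.ifLess_of_lt hxy (Comp.yields_pure _)))
        · rw [add_zero, ← add_assoc, hun]
          refine hX.merge hY hdis hxy ?_
          rw [← hun, hcard, hcX]
          exact clog_two_add_one_le (by omega) (by omega)
      · have hyx : y < x := lt_of_le_of_ne (not_lt.1 hxy) fun h =>
          Finset.disjoint_left.1 hdis hX.mem (h ▸ hY.mem)
        refine ⟨y, x :: ys, κ + (κ' + (Comp.tick x y + 0)), ?_, ?_⟩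
        · rw [knockout, dif_neg h1]
          exact hx.bind (hy.bind (Comp.Yields.ifLess_of_not_lt hxy (Comp.yields_pure _)))
        · rw [add_zero, ← add_assoc, hun, Finset.union_comm, add_comm κ,
            Comp.tick, add_comm (Pi.single x 1)]
          refine hY.merge hX hdis.symm hyx ?_
          rw [Finset.union_comm, ← hun, hcard, hcY]
          exact clog_two_add_one_le (by omega) (by omega)
termination_by l => l.length
decreasing_by
  · exact hlt
  · exact hld

/-- An upper bound on the comparisons of `e` in a computation that finds the two smallest elements
of `X`, in which the minimum takes part in at most `m` comparisons. -/
noncomputable def minCost (X : Finset α) (m : ℕ) (e : α) : ℕ :=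
  if e ∈ X then if ∀ x ∈ X, e ≤ x then min m (X.card - 1) else X.card - 1 else 0

theorem minCost_of_notMem {X : Finset α} {e : α} (he : e ∉ X) (m : ℕ) : minCost X m e = 0 :=
  if_neg he

theorem minCost_le_card (X : Finset α) (m : ℕ) (e : α) : minCost X m e ≤ X.card - 1 := by
  unfold minCost
  split_ifs <;> simp

theorem minCost_le {X : Finset α} {e : α} (he : ∀ x ∈ X, e ≤ x) (m : ℕ) : minCost X m e ≤ m := by
  unfold minCost
  rw [if_pos he]
  split_ifs <;> simp

theorem le_minCost {X : Finset α} {e : α} {m k : ℕ} (he : e ∈ X) (hk : k + 1 ≤ X.card)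
    (hm : (∀ x ∈ X, e ≤ x) → k ≤ m) : k ≤ minCost X m e := by
  unfold minCost
  rw [if_pos he]
  split_ifs with h
  · exact le_min (hm h) (by omega)
  · omega

/-- A direct loser plays again in the tournament among the losers, where it has at most `ls.length -
1` comparisons; the field `lose` leaves exactly this room below `X.card - 1`. The winner is absent
from the second tournament, so its logarithmic count stands. -/
theorem yields_tournamentMinimum (X : Finset α) :
    (tournamentMinimum X).Yields (twoMin X) (minCost X (Nat.clog 2 X.card)) := by
  rcases X.eq_empty_or_nonempty with rfl | hX
  · rw [tournamentMinimum, Finset.toList_empty, knockout, dif_pos (by simp), twoMin_empty]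
    refine Comp.Yields.mono (Comp.Yields.bind (Comp.yields_pure []) (w := []) (κ' := 0) ?_)
      fun e => by simp
    exact Comp.yields_pure _
  obtain ⟨w, ls, κ, hw, hW⟩ := exists_knockout X.toList X.nodup_toList (by
    simpa using hX.ne_empty)
  rw [Finset.toList_toFinset] at hW
  have hnd := List.nodup_cons.1 hW.nodup
  have huniq : ∀ e ∈ X, (∀ x ∈ X, e ≤ x) → e = w := fun e he h =>
    le_antisymm (h w hW.mem) (hW.le e he)
  by_cases hls : ls = []
  · subst hls
    have hXw : X = {w} := by
      refine Finset.eq_singleton_iff_unique_mem.2 ⟨hW.mem, fun x hx => ?_⟩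
      by_contra hxw
      obtain ⟨y, hy, -⟩ := hW.cover x hx hxw
      simp at hy
    have hk : (knockout ([] : List α)).Yields [] 0 := by
      rw [knockout, dif_pos (by simp)]
      exact Comp.yields_pure _
    refine Comp.Yields.mono (hw.bind (v := w :: []) (w := twoMin X) (κ' := 0 + 0) ?_) ?_
    · rw [hXw, twoMin_singleton]
      exact hk.bind (Comp.yields_pure _)
    · intro e
      by_cases he : e ∈ X
      · refine le_minCost he (hW.all e he) fun h => ?_
        rw [huniq e he h]
        exact hW.clog
      · simp [minCost_of_notMem he, hW.out e he]
  · obtain ⟨s, ss, κ', hs, hS⟩ := exists_knockout ls hnd.2 hls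
    have htwo : twoMin X = [w, s] := by
      have hsl : s ∈ ls := List.mem_toFinset.1 hS.mem
      refine IsTwoMin.twoMin_eq ⟨hW.mem, hW.sub s hsl, ?_, ?_⟩
      · exact lt_of_le_of_ne (hW.le s (hW.sub s hsl)) fun h => hnd.1 (h ▸ hsl)
      · intro x hx hxw
        obtain ⟨y, hy, hyx⟩ := hW.cover x hx hxw
        exact (hS.le y (List.mem_toFinset.2 hy)).trans hyx
    refine Comp.Yields.mono (hw.bind (v := w :: ls) (w := twoMin X) (κ' := κ' + 0) ?_) ?_
    · rw [htwo]
      exact hs.bind (Comp.yields_pure _)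
    · intro e
      by_cases he : e ∈ X
      · have hcl : ls.toFinset.card = ls.length := List.toFinset_card_of_nodup hnd.2
        refine le_minCost he ?_ fun h => ?_
        · by_cases hel : e ∈ ls
          · have h1 := hW.lose e hel
            have h2 := hS.all e (List.mem_toFinset.2 hel)
            change κ e + (κ' e + 0) + 1 ≤ _
            omega
          · have h1 := hW.all e he
            have h2 := hS.out e (by simpa using hel)
            change κ e + (κ' e + 0) + 1 ≤ _
            omega
        · have hew := huniq e he h
          have h2 := hS.out e (by rw [hew]; simpa using hnd.1)
          change κ e + (κ' e + 0) ≤ _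
          rw [h2, hew]
          exact hW.clog
      · have h2 := hS.out e fun h => he (hW.sub e (List.mem_toFinset.1 h))
        change κ e + (κ' e + 0) ≤ _
        simp [h2, hW.out e he]

end Tournament

/-! ### SampleMinimum: result, worst case cost and recursion -/

theorem floor_rpow_two_thirds_pow_le (n : ℕ) : ⌊(n : ℝ) ^ (2 / 3 : ℝ)⌋₊ ^ 3 ≤ n ^ 2 := by
  have h2 : (⌊(n : ℝ) ^ (2 / 3 : ℝ)⌋₊ : ℝ) ^ 3 ≤ (n : ℝ) ^ 2 := by
    calc (⌊(n : ℝ) ^ (2 / 3 : ℝ)⌋₊ : ℝ) ^ 3 ≤ ((n : ℝ) ^ (2 / 3 : ℝ)) ^ 3 := by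
          gcongr
          exact Nat.floor_le (by positivity)
      _ = (n : ℝ) ^ 2 := by
        rw [← Real.rpow_natCast, ← Real.rpow_mul (by positivity)]
        norm_num
  exact_mod_cast h2

theorem lt_floor_rpow_two_thirds_succ_pow (n : ℕ) :
    n ^ 2 < (⌊(n : ℝ) ^ (2 / 3 : ℝ)⌋₊ + 1) ^ 3 := by
  have h2 : (n : ℝ) ^ 2 < ((⌊(n : ℝ) ^ (2 / 3 : ℝ)⌋₊ : ℝ) + 1) ^ 3 := by
    calc (n : ℝ) ^ 2 = ((n : ℝ) ^ (2 / 3 : ℝ)) ^ 3 := by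
          rw [← Real.rpow_natCast ((n : ℝ) ^ (2 / 3 : ℝ)), ← Real.rpow_mul (by positivity)]
          norm_num
      _ < ((⌊(n : ℝ) ^ (2 / 3 : ℝ)⌋₊ : ℝ) + 1) ^ 3 := by
          gcongr
          exact Nat.lt_floor_add_one _
  exact_mod_cast h2

theorem two_le_floor_rpow_two_thirds {n : ℕ} (hn : 8 < n) :
    2 ≤ ⌊(n : ℝ) ^ (2 / 3 : ℝ)⌋₊ := by
  by_contra h
  have h1 := lt_floor_rpow_two_thirds_succ_pow n
  have h2 : (⌊(n : ℝ) ^ (2 / 3 : ℝ)⌋₊ + 1) ^ 3 ≤ 2 ^ 3 := Nat.pow_le_pow_left (by omega) 3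
  nlinarith

namespace Comp
variable {α : Type u} [LinearOrder α]

theorem sum_tick_apply {p : α} {S : Finset α} (hp : p ∉ S) (e : α) :
    (∑ x ∈ S, tick x p) e = if e = p then S.card else if e ∈ S then 1 else 0 := by
  rw [Finset.sum_apply]
  simp only [tick_apply, Finset.sum_add_distrib, Finset.sum_ite_eq, Finset.sum_const]
  split_ifs with h1 h2 h2 <;> simp_all

end Comp

section SampleMinimum
variable {α : Type u} [LinearOrder α]

/-- The elements of `T` that are smaller than all but at most one element of `S`. -/
noncomputable def belowSecond (S T : Finset α) : Finset α :=
  T.filter fun x => (S.filter (· ≤ x)).card ≤ 1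

theorem belowSecond_subset (S T : Finset α) : belowSecond S T ⊆ T := Finset.filter_subset _ _

/-- Replaces the threshold `b` by a condition on `S` and `T` alone, so that the sizes of `D` and `C`
can be treated by counting subsets. -/
theorem IsTwoMin.belowSecond_eq {S : Finset α} {a b : α} (h : IsTwoMin S a b) {T : Finset α}
    (hST : Disjoint S T) : T.filter (· < b) = belowSecond S T := by
  refine Finset.filter_congr fun x hx => ?_
  have hxb : x ≠ b := fun hxb => Finset.disjoint_right.1 hST hx (hxb ▸ h.snd_mem)
  constructor
  · intro hlt
    refine Finset.card_le_one.2 fun y hy y' hy' => ?_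
    rw [Finset.mem_filter] at hy hy'
    have hy1 : y = a := by
      by_contra hne
      exact ((h.le y hy.1 hne).trans hy.2).not_gt hlt
    have hy1' : y' = a := by
      by_contra hne
      exact ((h.le y' hy'.1 hne).trans hy'.2).not_gt hlt
    rw [hy1, hy1']
  · intro hc
    by_contra hlt
    have hle := not_lt.1 hlt
    exact h.lt.ne (Finset.card_le_one.1 hc a
      (Finset.mem_filter.2 ⟨h.fst_mem, h.lt.le.trans hle⟩) b
      (Finset.mem_filter.2 ⟨h.snd_mem, hle⟩))

theorem IsTwoMin.yields_filterSecond {S : Finset α} {a b : α} (h : IsTwoMin S a b) {T : Finset α}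
    (hST : Disjoint S T) :
    (filterSecond (twoMin S) T).Yields ⟨belowSecond S T, belowSecond_subset S T⟩
      (∑ x ∈ T, Comp.tick x b) := by
  have h1 := Comp.yields_filterLess b T
  have h2 : (⟨T.filter (· < b), Finset.filter_subset _ _⟩ : {D : Finset α // D ⊆ T}) =
      ⟨belowSecond S T, belowSecond_subset S T⟩ := Subtype.ext (h.belowSecond_eq hST)
  rw [h2] at h1
  rw [h.twoMin_eq]
  exact h1

theorem IsTwoMin.mem_belowSecond {S : Finset α} {a b : α} (h : IsTwoMin S a b) {T : Finset α}
    (hST : Disjoint S T) {x : α} : x ∈ belowSecond S T ↔ x ∈ T ∧ x < b := by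
  rw [← h.belowSecond_eq hST, Finset.mem_filter]

/-- The cost of `combinePairs` on the two smallest elements of `D` and a pair with minimum `q`. -/
noncomputable def combineCost (q : α) (D : Finset α) (e : α) : ℕ :=
  if e = q then min 2 D.card else if e ∈ D then 1 else 0

/-- All elements outside `belowSecond S T` other than `a` are at least `b`, hence only `a`, `b` and
the two smallest elements of that set compete, and `b` survives only if the set is empty. -/
theorem IsTwoMin.yields_combinePairs {S : Finset α} {a b : α} (h : IsTwoMin S a b) {T : Finset α}
    (hST : Disjoint S T) :
    (combinePairs (twoMin (belowSecond S T)) (twoMin S)).Yields (twoMin (S ∪ T))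
      (combineCost a (belowSecond S T)) := by
  have hmem := fun x => h.mem_belowSecond hST (x := x)
  have hne : ∀ {x}, x ∈ belowSecond S T → x ≠ a := fun hx hxa =>
    Finset.disjoint_left.1 hST h.fst_mem (hxa ▸ ((hmem _).1 hx).1)
  have hle : ∀ x ∈ S ∪ T, x ∉ belowSecond S T → x ≠ a → b ≤ x := by
    intro x hx hxD hxa
    rcases Finset.mem_union.1 hx with hx | hx
    · exact h.le x hx hxa
    · by_contra hlt
      exact hxD ((hmem x).2 ⟨hx, not_le.1 hlt⟩)
  have haST : a ∈ S ∪ T := Finset.mem_union_left _ h.fst_mem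
  rw [h.twoMin_eq]
  have hcard : (belowSecond S T).card = 0 ∨ (belowSecond S T).card = 1 ∨
      2 ≤ (belowSecond S T).card := by omega
  rcases hcard with h0 | h1 | h2
  · rw [Finset.card_eq_zero] at h0
    rw [h0, twoMin_empty]
    have hX : IsTwoMin (S ∪ T) a b := ⟨haST, Finset.mem_union_left _ h.snd_mem, h.lt,
      fun x hx hxa => hle x hx (by simp [h0]) hxa⟩
    rw [hX.twoMin_eq]
    exact (Comp.yields_pure _).mono fun e => Nat.zero_le _
  · obtain ⟨p, hp⟩ := Finset.card_eq_one.1 h1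
    have hpD : p ∈ belowSecond S T := by simp [hp]
    have hpb := ((hmem p).1 hpD).2
    have hpX : p ∈ S ∪ T := Finset.mem_union_right _ ((hmem p).1 hpD).1
    rw [hp] at hle ⊢
    rw [twoMin_singleton]
    have hcost : Comp.tick p a + 0 ≤ combineCost a {p} := by
      intro e
      simp only [combineCost, Comp.tick_apply, Pi.add_apply, Pi.zero_apply, Finset.mem_singleton,
        Finset.card_singleton]
      have hpa := hne hpD
      clear hmem hle hne
      split_ifs <;> simp_all
    by_cases hlt : p < a
    · have hX : IsTwoMin (S ∪ T) p a := by
        refine ⟨hpX, haST, hlt, fun x hx hxp => ?_⟩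
        by_cases hxa : x = a
        · exact hxa.ge
        · exact h.lt.le.trans (hle x hx (by simpa using hxp) hxa)
      rw [hX.twoMin_eq]
      exact (Comp.Yields.ifLess_of_lt hlt (Comp.yields_pure _)).mono hcost
    · have hX : IsTwoMin (S ∪ T) a p := by
        refine ⟨haST, hpX, lt_of_le_of_ne (not_lt.1 hlt) (hne hpD).symm, fun x hx hxa => ?_⟩
        by_cases hxp : x = p
        · exact hxp.ge
        · exact hpb.le.trans (hle x hx (by simpa using hxp) hxa)
      rw [hX.twoMin_eq]
      exact (Comp.Yields.ifLess_of_not_lt hlt (Comp.yields_pure _)).mono hcost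
  · obtain ⟨p, p', hp⟩ := exists_isTwoMin h2
    rw [hp.twoMin_eq]
    have hpb := ((hmem p).1 hp.fst_mem).2
    have hpb' := ((hmem p').1 hp.snd_mem).2
    have hpX : p ∈ S ∪ T := Finset.mem_union_right _ ((hmem p).1 hp.fst_mem).1
    have hpX' : p' ∈ S ∪ T := Finset.mem_union_right _ ((hmem p').1 hp.snd_mem).1
    have hpa := hne hp.fst_mem
    have hpa' := hne hp.snd_mem
    have hcost : Comp.tick p a + (Comp.tick p' a + 0) ≤ combineCost a (belowSecond S T) := by
      intro e
      simp only [combineCost, Comp.tick_apply, Pi.add_apply, Pi.zero_apply]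
      have h3 := hp.fst_mem
      have h4 := hp.snd_mem
      have h5 := hp.lt.ne
      clear hmem hle hne
      split_ifs <;> simp_all
    by_cases hlt : p < a
    · by_cases hlt' : p' < a
      · have hX : IsTwoMin (S ∪ T) p p' := by
          refine ⟨hpX, hpX', hp.lt, fun x hx hxp => ?_⟩
          by_cases hxD : x ∈ belowSecond S T
          · exact hp.le x hxD hxp
          · by_cases hxa : x = a
            · exact hxa ▸ hlt'.le
            · exact hpb'.le.trans (hle x hx hxD hxa)
        rw [hX.twoMin_eq]
        exact (Comp.Yields.ifLess_of_lt hlt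
          (Comp.Yields.ifLess_of_lt hlt' (Comp.yields_pure _))).mono hcost
      · have hX : IsTwoMin (S ∪ T) p a := by
          refine ⟨hpX, haST, hlt, fun x hx hxp => ?_⟩
          by_cases hxD : x ∈ belowSecond S T
          · exact (not_lt.1 hlt').trans (hp.le x hxD hxp)
          · by_cases hxa : x = a
            · exact hxa.ge
            · exact h.lt.le.trans (hle x hx hxD hxa)
        rw [hX.twoMin_eq]
        exact (Comp.Yields.ifLess_of_lt hlt
          (Comp.Yields.ifLess_of_not_lt hlt' (Comp.yields_pure _))).mono hcost
    · have hX : IsTwoMin (S ∪ T) a p := by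
        refine ⟨haST, hpX, lt_of_le_of_ne (not_lt.1 hlt) hpa.symm, fun x hx hxa => ?_⟩
        by_cases hxD : x ∈ belowSecond S T
        · exact hp.fst_le hxD
        · exact hpb.le.trans (hle x hx hxD hxa)
      rw [hX.twoMin_eq]
      refine (Comp.Yields.ifLess_of_not_lt hlt (Comp.yields_pure _)).mono (le_trans ?_ hcost)
      exact add_le_add le_rfl (by simp)

/-- Joining `T` to `S` must not break the worst case `card - 1`. In `S` only `a` and `b` pay, each
at most `|T|`. An element of `T` pays one for the filter and, if it survives, at most `|D| - 1` for
the recursion and one for the merge; this total `|D| + 1` fits since `|S| ≥ 2`. The overall minimum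
pays at most two besides its recursive call, in either case. -/
theorem IsTwoMin.minCost_add_le {S : Finset α} {a b : α} (h : IsTwoMin S a b) {T : Finset α}
    (hST : Disjoint S T) {m m' k : ℕ} (hm : m + 2 ≤ k) (hm' : m' + 2 ≤ k) :
    minCost S m + ((∑ x ∈ T, Comp.tick x b) + (minCost (belowSecond S T) m' +
      combineCost a (belowSecond S T))) ≤ minCost (S ∪ T) k := by
  intro e
  have hbT : b ∉ T := Finset.disjoint_left.1 hST h.snd_mem
  have haT : a ∉ T := Finset.disjoint_left.1 hST h.fst_mem
  have hcard := Finset.card_union_of_disjoint hST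
  have hD : (belowSecond S T).card ≤ T.card := Finset.card_le_card (belowSecond_subset S T)
  have hS : 1 < S.card := Finset.one_lt_card.2 ⟨a, h.fst_mem, b, h.snd_mem, h.lt.ne⟩
  have hmS := minCost_le_card S m e
  have hmD := minCost_le_card (belowSecond S T) m' e
  simp only [Pi.add_apply, Comp.sum_tick_apply hbT, combineCost]
  by_cases heS : e ∈ S
  · have heT : e ∉ T := Finset.disjoint_left.1 hST heS
    have heD : e ∉ belowSecond S T := fun h => heT (belowSecond_subset S T h)
    rw [minCost_of_notMem heD]
    refine le_minCost (Finset.mem_union_left _ heS) ?_ fun hmin => ?_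
    · by_cases hea : e = a
      · have heb : e ≠ b := hea ▸ h.lt.ne
        simp only [hea, h.lt.ne, haT, if_true, if_false]
        rw [hea] at hmS
        omega
      · simp only [hea, heD, heT, if_false]
        split_ifs <;> omega
    · have hea : e = a := le_antisymm (hmin a (Finset.mem_union_left _ h.fst_mem)) (h.fst_le heS)
      have := minCost_le (fun x hx => hmin x (Finset.mem_union_left _ hx)) m
      simp only [hea, h.lt.ne, haT, if_true, if_false] at this ⊢
      omega
  · rw [minCost_of_notMem heS]
    by_cases heT : e ∈ T
    · have hea : e ≠ a := fun h => haT (h ▸ heT)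
      have heb : e ≠ b := fun h => hbT (h ▸ heT)
      simp only [hea, heb, heT, if_true, if_false]
      refine le_minCost (Finset.mem_union_right _ heT) ?_ fun hmin => ?_
      · by_cases heD : e ∈ belowSecond S T
        · have := Finset.card_pos.2 ⟨e, heD⟩
          simp only [heD, if_true]
          omega
        · rw [minCost_of_notMem heD]
          have := Finset.card_pos.2 ⟨e, heT⟩
          simp only [heD, if_false]
          omega
      · have := minCost_le (fun x hx => hmin x
          (Finset.mem_union_right _ (belowSecond_subset S T hx))) m'
        split_ifs <;> omega
    · have heD : e ∉ belowSecond S T := fun h => heT (belowSecond_subset S T h)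
      have hea : e ≠ a := fun hea => heS (hea ▸ h.fst_mem)
      have heb : e ≠ b := fun heb => heS (heb ▸ h.snd_mem)
      simp [minCost_of_notMem heD, hea, heb, heD, heT]

theorem minCost_mono (X : Finset α) {m m' : ℕ} (h : m ≤ m') : minCost X m ≤ minCost X m' := by
  intro e
  unfold minCost
  split_ifs
  · exact min_le_min_right _ h
  · exact le_rfl
  · exact le_rfl

/-- Correctness and the worst case for arbitrary samples: `B`, `D` and `C` have at most half the
size of `X`, rounded up, so `Nat.clog` drops by one per level, while the minimum pays at most four
per level. -/
theorem yields_sampleMinimum (X : Finset α) :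
    (sampleMinimum X).Yields (twoMin X) (minCost X (4 * Nat.clog 2 X.card)) := by
  induction hn : X.card using Nat.strong_induction_on generalizing X with
  | _ n ih =>
    by_cases h : X.card ≤ 8
    · rw [sampleMinimum, dif_pos h]
      rw [← hn]
      exact (yields_tournamentMinimum X).mono (minCost_mono X (by omega))
    · rw [sampleMinimum, dif_neg h]
      refine Comp.yields_sample_bind fun A => Comp.yields_sample_bind fun B => ?_
      obtain ⟨A, hA⟩ := A
      obtain ⟨B, hB⟩ := B
      have hA' := Finset.mem_powersetCard.1 hA
      have hB' := Finset.mem_powersetCard.1 hB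
      have hk := two_le_floor_rpow_two_thirds (not_le.1 h)
      have hka := floor_rpow_two_thirds_le (not_le.1 h)
      obtain ⟨b₁, b₂, hb⟩ := exists_isTwoMin (hB'.2.symm ▸ hk)
      obtain ⟨a₁, a₂, ha⟩ := exists_isTwoMin (X := A) (by omega)
      have hBd : Disjoint B (A \ B) := Finset.disjoint_sdiff
      have hAd : Disjoint A (X \ A) := Finset.disjoint_sdiff
      have hBA : B ∪ (A \ B) = A := Finset.union_sdiff_of_subset hB'.1
      have hAX : A ∪ (X \ A) = X := Finset.union_sdiff_of_subset hA'.1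
      have hDc : (belowSecond B (A \ B)).card ≤ (n + 1) / 2 := by
        rw [← hn, ← hA'.2]
        exact Finset.card_le_card ((belowSecond_subset _ _).trans Finset.sdiff_subset)
      have hCc : (belowSecond A (X \ A)).card ≤ (n + 1) / 2 := by
        refine (Finset.card_le_card (belowSecond_subset _ _)).trans ?_
        rw [Finset.card_sdiff_of_subset hA'.1]
        omega
      have hBn : B.card ≤ (n + 1) / 2 := by omega
      have hcomb := hb.yields_combinePairs hBd
      have hcomb' := ha.yields_combinePairs hAd
      rw [hBA] at hcomb
      rw [hAX] at hcomb'
      refine Comp.Yields.mono ((ih B.card (by omega) B rfl).bind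
        ((hb.yields_filterSecond hBd).bind
        ((ih _ (hDc.trans_lt (by omega)) (belowSecond B (A \ B)) rfl).bind
        (hcomb.bind ((ha.yields_filterSecond hAd).bind
        ((yields_tournamentMinimum _).bind hcomb')))))) ?_
      -- The drop of `Nat.clog` frees four comparisons: two are spent here on joining `B` and `A \
      -- B`, and two are kept for joining `A` and `X \ A`.
      have h1 := hb.minCost_add_le hBd (m := 4 * Nat.clog 2 B.card)
        (m' := 4 * Nat.clog 2 (belowSecond B (A \ B)).card) (k := 4 * Nat.clog 2 n - 2)
        (by have := clog_two_add_one_le (by omega) hBn; omega)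
        (by have := clog_two_add_one_le (by omega) hDc; omega)
      have h2 := ha.minCost_add_le hAd (m := 4 * Nat.clog 2 n - 2)
        (m' := Nat.clog 2 (belowSecond A (X \ A)).card) (k := 4 * Nat.clog 2 n)
        (by have := clog_two_add_one_le (by omega) hBn; omega)
        (by have := clog_two_add_one_le (by omega) hCc; omega)
      rw [hBA] at h1
      rw [hAX] at h2
      intro e
      have h1e := h1 e
      have h2e := h2 e
      simp only [Pi.add_apply] at h1e h2e ⊢
      omega

theorem Comp.mean_const_le {ι : Type*} {𝒜 : Finset ι} {g : ι → ℝ≥0∞} {c : ℝ≥0∞}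
    (h : ∀ T ∈ 𝒜, g T ≤ c) : mean 𝒜 g ≤ c := by
  rcases 𝒜.eq_empty_or_nonempty with rfl | hne
  · simp [mean]
  refine (mean_mono (g' := fun _ => c) h).trans_eq ?_
  rw [mean, Finset.sum_const, nsmul_eq_mul, ← mul_assoc, ENNReal.inv_mul_cancel, one_mul]
  · exact_mod_cast hne.card_pos.ne'
  · exact ENNReal.natCast_ne_top _

theorem Comp.mean_mul_left {ι : Type*} (𝒜 : Finset ι) (g : ι → ℝ≥0∞) (c : ℝ≥0∞) :
    mean 𝒜 (fun T => c * g T) = c * mean 𝒜 g := by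
  rw [mean, mean, ← Finset.mul_sum]
  ring

/-- The recursion for the moment generating function of the comparisons of the minimum. -/
theorem mgf_sampleMinimum_le {X : Finset α} {e : α} {z : ℝ≥0∞} (hX : 8 < X.card) (hz : 1 ≤ z)
    (he : e ∈ X) (hmin : ∀ x ∈ X, e ≤ x) :
    (sampleMinimum X).mgf z e ≤ Comp.mean (X.powersetCard ((X.card + 1) / 2)) fun A =>
      if e ∈ A then z ^ 4 * Comp.mean (A.powersetCard ⌊(X.card : ℝ) ^ (2 / 3 : ℝ)⌋₊) fun B =>
        if e ∈ B then (sampleMinimum B).mgf z e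
        else (sampleMinimum (belowSecond B (A \ B))).mgf z e
      else z ^ (2 + Nat.clog 2 (belowSecond A (X \ A)).card) := by
  rw [sampleMinimum, dif_neg (not_le.2 hX)]
  refine Comp.mgf_sample_bind_le fun A => ?_
  obtain ⟨A, hA⟩ := A
  have hA' := Finset.mem_powersetCard.1 hA
  have hk := two_le_floor_rpow_two_thirds hX
  have hka := floor_rpow_two_thirds_le hX
  obtain ⟨a₁, a₂, ha⟩ := exists_isTwoMin (X := A) (by omega)
  have hAd : Disjoint A (X \ A) := Finset.disjoint_sdiff
  have hAX : A ∪ (X \ A) = X := Finset.union_sdiff_of_subset hA'.1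
  have hcomb' := ha.yields_combinePairs hAd
  rw [hAX] at hcomb'
  have ha1 : e ∈ A → e = a₁ := fun heA => le_antisymm (hmin _ (hA'.1 ha.fst_mem)) (ha.fst_le heA)
  have hea2 : e ≠ a₂ := fun h =>
    (hmin _ (hA'.1 ha.fst_mem)).not_gt (h ▸ ha.lt)
  have ha2 : a₂ ∉ X \ A := by simp [ha.snd_mem]
  refine (Comp.mgf_sample_bind_le (g := fun B =>
    if e ∈ A then z ^ 4 * if e ∈ B then (sampleMinimum B).mgf z e
      else (sampleMinimum (belowSecond B (A \ B))).mgf z e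
    else z ^ (2 + Nat.clog 2 (belowSecond A (X \ A)).card)) fun B => ?_).trans ?_
  · obtain ⟨B, hB⟩ := B
    have hB' := Finset.mem_powersetCard.1 hB
    obtain ⟨b₁, b₂, hb⟩ := exists_isTwoMin (hB'.2.symm ▸ hk)
    have hBd : Disjoint B (A \ B) := Finset.disjoint_sdiff
    have hBA : B ∪ (A \ B) = A := Finset.union_sdiff_of_subset hB'.1
    have hcomb := hb.yields_combinePairs hBd
    rw [hBA] at hcomb
    have hb1 : e ∈ B → e = b₁ := fun heB =>
      le_antisymm (hmin _ (hA'.1 (hB'.1 hb.fst_mem))) (hb.fst_le heB)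
    have heb2 : e ≠ b₂ := fun h =>
      (hmin _ (hA'.1 (hB'.1 hb.fst_mem))).not_gt (h ▸ hb.lt)
    have hb2 : b₂ ∉ A \ B := by simp [hb.snd_mem]
    have y1 := yields_sampleMinimum B
    have y2 := hb.yields_filterSecond hBd
    have y3 := yields_sampleMinimum (belowSecond B (A \ B))
    have y5 := ha.yields_filterSecond hAd
    have y6 := yields_tournamentMinimum (belowSecond A (X \ A))
    have m1 := y1.mgf_le hz e
    have m2 := y2.mgf_le hz e
    have m3 := y3.mgf_le hz e
    have m4 := hcomb.mgf_le hz e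
    have m5 := y5.mgf_le hz e
    have m6 := y6.mgf_le hz e
    have m7 := hcomb'.mgf_le hz e
    rw [Comp.sum_tick_apply hb2, if_neg heb2] at m2
    rw [Comp.sum_tick_apply ha2, if_neg hea2] at m5
    have hsubD := belowSecond_subset B (A \ B)
    have hsubC := belowSecond_subset A (X \ A)
    dsimp only
    rw [y1.mgf_bind, y2.mgf_bind, y3.mgf_bind, hcomb.mgf_bind, y5.mgf_bind, y6.mgf_bind]
    -- Apart from the recursive call or the tournament, `e` pays `2 + 2` in the two merges if `e ∈
    -- B`; one for the filter and `1 + 2` for the merges if `e ∈ A \ B`; and one for the filter and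
    -- one for the last merge if `e ∉ A`.
    by_cases heA : e ∈ A
    · have heC : e ∉ belowSecond A (X \ A) := fun h => by
        simpa [heA] using hsubC h
      rw [minCost_of_notMem heC, pow_zero] at m6
      have heC' : e ∉ X \ A := by simp [heA]
      rw [if_neg heC', pow_zero] at m5
      have m7' : (combinePairs (twoMin (belowSecond A (X \ A))) (twoMin A)).mgf z e ≤ z ^ 2 := by
        refine m7.trans (pow_le_pow_right₀ hz ?_)
        rw [combineCost, if_pos (ha1 heA)]
        exact min_le_left _ _
      rw [if_pos heA]
      by_cases heB : e ∈ B
      · have heD' : e ∉ A \ B := by simp [heB]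
        have heD : e ∉ belowSecond B (A \ B) := fun h => heD' (hsubD h)
        rw [minCost_of_notMem heD, pow_zero] at m3
        rw [if_neg heD', pow_zero] at m2
        have m4' : (combinePairs (twoMin (belowSecond B (A \ B))) (twoMin B)).mgf z e ≤ z ^ 2 := by
          refine m4.trans (pow_le_pow_right₀ hz ?_)
          rw [combineCost, if_pos (hb1 heB)]
          exact min_le_left _ _
        rw [if_pos heB]
        calc _ ≤ (sampleMinimum B).mgf z e * (1 * (1 * (z ^ 2 * (1 * (1 * z ^ 2))))) := by
              gcongr
          _ = _ := by ring
      · have heD' : e ∈ A \ B := by simp [heB, heA]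
        rw [if_pos heD'] at m2
        rw [minCost_of_notMem heB, pow_zero] at m1
        have m4' : (combinePairs (twoMin (belowSecond B (A \ B))) (twoMin B)).mgf z e ≤ z ^ 1 := by
          refine m4.trans (pow_le_pow_right₀ hz ?_)
          rw [combineCost, if_neg (fun h : e = b₁ => heB (h ▸ hb.fst_mem))]
          split_ifs <;> simp
        rw [if_neg heB]
        calc _ ≤ 1 * (z ^ 1 * ((sampleMinimum (belowSecond B (A \ B))).mgf z e *
                (z ^ 1 * (1 * (1 * z ^ 2))))) := by gcongr
          _ = _ := by ring
    · have heB : e ∉ B := fun h => heA (hB'.1 h)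
      have heD' : e ∉ A \ B := by simp [heA]
      have heD : e ∉ belowSecond B (A \ B) := fun h => heD' (hsubD h)
      have heC' : e ∈ X \ A := by simp [heA, he]
      rw [minCost_of_notMem heB, pow_zero] at m1
      rw [if_neg heD', pow_zero] at m2
      rw [minCost_of_notMem heD, pow_zero] at m3
      rw [combineCost, if_neg (fun h : e = b₁ => heB (h ▸ hb.fst_mem)), if_neg heD, pow_zero] at m4
      rw [if_pos heC'] at m5
      have m6' : (tournamentMinimum (belowSecond A (X \ A))).mgf z e ≤
          z ^ Nat.clog 2 (belowSecond A (X \ A)).card :=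
        m6.trans (pow_le_pow_right₀ hz (minCost_le
          (fun x hx => hmin x (Finset.sdiff_subset (hsubC hx))) _))
      have m7' : (combinePairs (twoMin (belowSecond A (X \ A))) (twoMin A)).mgf z e ≤ z ^ 1 := by
        refine m7.trans (pow_le_pow_right₀ hz ?_)
        rw [combineCost, if_neg (fun h : e = a₁ => heA (h ▸ ha.fst_mem))]
        split_ifs <;> simp
      rw [if_neg heA]
      calc _ ≤ 1 * (1 * (1 * (1 * (z ^ 1 *
              (z ^ Nat.clog 2 (belowSecond A (X \ A)).card * z ^ 1))))) := by gcongr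
        _ = _ := by ring
  · by_cases heA : e ∈ A
    · simp only [if_pos heA]
      exact (Comp.mean_mul_left _ _ _).le
    · simp only [if_neg heA]
      exact Comp.mean_const_le fun _ _ => le_rfl

end SampleMinimum

/-! ### Random subsets -/

/-- The quotient of the two binomials is `1 - k / (m + 1)`, at most `1 - k / n`. Iterated, this
bounds the chance that a random `k`-subset of an `n`-set misses `i` given elements by `(1 - k / n) ^
i`. -/
theorem choose_mul_le_sub_mul_choose {m n k : ℕ} (h : m + 1 ≤ n) :
    m.choose k * n ≤ (n - k) * (m + 1).choose k := by
  rcases lt_or_ge m k with hk | hk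
  · simp [Nat.choose_eq_zero_of_lt hk]
  · obtain ⟨d, rfl⟩ := Nat.exists_eq_add_of_le h
    obtain ⟨r, rfl⟩ := Nat.exists_eq_add_of_le hk
    have h1 := Nat.choose_mul_succ_eq (k + r) k
    have h2 : k + r + 1 - k = r + 1 := by omega
    have h3 : k + r + 1 + d - k = r + 1 + d := by omega
    rw [h2] at h1
    rw [h3]
    have h4 : (k + r).choose k ≤ (k + r + 1).choose k := Nat.choose_le_choose k (by omega)
    nlinarith [Nat.mul_le_mul_right d h4]

theorem choose_sub_mul_pow_le (n k : ℕ) : ∀ i ≤ n,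
    (n - i).choose k * n ^ i ≤ (n - k) ^ i * n.choose k
  | 0, _ => by simp
  | i + 1, hi => by
    have h1 := choose_sub_mul_pow_le n k i (by omega)
    have h2 := choose_mul_le_sub_mul_choose (m := n - (i + 1)) (n := n) (k := k) (by omega)
    have h3 : n - (i + 1) + 1 = n - i := by omega
    rw [h3] at h2
    calc (n - (i + 1)).choose k * n ^ (i + 1) = (n - (i + 1)).choose k * n * n ^ i := by ring
      _ ≤ (n - k) * (n - i).choose k * n ^ i := by gcongr
      _ = (n - k) * ((n - i).choose k * n ^ i) := by ring
      _ ≤ (n - k) * ((n - k) ^ i * n.choose k) := by gcongr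
      _ = (n - k) ^ (i + 1) * n.choose k := by ring

section Subsets
variable {α : Type u} [LinearOrder α]

theorem card_powersetCard_disjoint_mul_pow_le {X I : Finset α} (hI : I ⊆ X) (k : ℕ) :
    ((X.powersetCard k).filter fun A => Disjoint A I).card * X.card ^ I.card ≤
      (X.card - k) ^ I.card * X.card.choose k := by
  have h : (X.powersetCard k).filter (fun A => Disjoint A I) = (X \ I).powersetCard k := by
    ext A
    simp only [Finset.mem_filter, Finset.mem_powersetCard, Finset.subset_sdiff]
    tauto
  rw [h, Finset.card_powersetCard, Finset.card_sdiff_of_subset hI]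
  exact choose_sub_mul_pow_le _ _ _ (Finset.card_le_card hI)

theorem exists_initial_segment (X : Finset α) : ∀ m ≤ X.card,
    ∃ I ⊆ X, I.card = m ∧ ∀ x ∈ I, ∀ y ∈ X, y ≤ x → y ∈ I
  | 0, _ => ⟨∅, by simp⟩
  | m + 1, hm => by
    obtain ⟨I, hIX, hIm, hI⟩ := exists_initial_segment X m (by omega)
    have hne : (X \ I).Nonempty := by
      rw [← Finset.card_pos, Finset.card_sdiff_of_subset hIX]
      omega
    have ha := Finset.min'_mem _ hne
    have ha' := Finset.mem_sdiff.1 ha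
    refine ⟨insert ((X \ I).min' hne) I, Finset.insert_subset ha'.1 hIX, ?_, ?_⟩
    · rw [Finset.card_insert_of_notMem ha'.2, hIm]
    · intro x hx y hy hyx
      by_cases hyI : y ∈ I
      · exact Finset.mem_insert_of_mem hyI
      · rcases Finset.mem_insert.1 hx with rfl | hx
        · exact Finset.mem_insert.2 (Or.inl (le_antisymm hyx
            (Finset.min'_le _ _ (Finset.mem_sdiff.2 ⟨hy, hyI⟩))))
        · exact absurd (hI x hx y hy hyx) hyI

/-- If two elements of `A` were at most `max I`, then `min A` and all of `belowSecond A (X \ A)`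
would lie in `I` strictly below `max I`, which is one element too many. So a large `C` forces `A` to
nearly miss an initial segment. -/
theorem card_inter_le_one_of_le_card_belowSecond {X A I : Finset α} (hAX : A ⊆ X)
    (hA : A.Nonempty) (hIX : I ⊆ X) (hI : ∀ x ∈ I, ∀ y ∈ X, y ≤ x → y ∈ I)
    (hc : I.card ≤ (belowSecond A (X \ A)).card + 1) : (A ∩ I).card ≤ 1 := by
  rcases I.eq_empty_or_nonempty with rfl | hne
  · simp
  set x := I.max' hne with hx
  have hxI : x ∈ I := I.max'_mem hne
  have hx1 : (A.filter (· ≤ x)).card ≤ 1 := by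
    by_contra hlt
    have hdown : ∀ y ∈ X, (A.filter (· ≤ y)).card ≤ 1 → y ∈ I.erase x := by
      intro y hy hy1
      have hyx : y < x := by
        by_contra hxy
        refine hlt (le_trans (Finset.card_le_card fun a ha => ?_) hy1)
        rw [Finset.mem_filter] at ha ⊢
        exact ⟨ha.1, ha.2.trans (not_lt.1 hxy)⟩
      exact Finset.mem_erase.2 ⟨hyx.ne, hI x hxI y hy hyx.le⟩
    have hsub : insert (A.min' hA) (belowSecond A (X \ A)) ⊆ I.erase x := by
      intro y hy
      rcases Finset.mem_insert.1 hy with rfl | hy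
      · refine hdown _ (hAX (A.min'_mem hA)) (Finset.card_le_one.2 fun a ha a' ha' => ?_)
        rw [Finset.mem_filter] at ha ha'
        rw [le_antisymm ha.2 (A.min'_le a ha.1), le_antisymm ha'.2 (A.min'_le a' ha'.1)]
      · rw [belowSecond, Finset.mem_filter] at hy
        exact hdown y (Finset.mem_sdiff.1 hy.1).1 hy.2
    have h1 := Finset.card_le_card hsub
    have hnot : A.min' hA ∉ belowSecond A (X \ A) := fun h =>
      (Finset.mem_sdiff.1 (belowSecond_subset _ _ h)).2 (A.min'_mem hA)
    rw [Finset.card_insert_of_notMem hnot, Finset.card_erase_of_mem hxI] at h1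
    have := Finset.card_pos.2 hne
    omega
  refine le_trans (Finset.card_le_card fun a ha => ?_) hx1
  rw [Finset.mem_inter] at ha
  exact Finset.mem_filter.2 ⟨ha.1, I.le_max' a ha.2⟩

/-- Only few subsets `A` have many elements outside `A` below their second smallest element. -/
theorem card_belowSecond_tail (X : Finset α) {k : ℕ} (hk : 1 ≤ k) (t : ℕ) :
    ((X.powersetCard k).filter fun A => t ≤ (belowSecond A (X \ A)).card).card *
      X.card ^ ((t + 1) / 2) ≤ 2 * ((X.card - k) ^ ((t + 1) / 2) * X.card.choose k) := by
  rcases lt_or_ge X.card (t + 1) with ht | ht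
  · rw [Finset.filter_false_of_mem, Finset.card_empty, zero_mul]
    · exact Nat.zero_le _
    · intro A hA
      rw [Finset.mem_powersetCard] at hA
      have h1 := Finset.card_le_card (belowSecond_subset A (X \ A))
      rw [Finset.card_sdiff_of_subset hA.1, hA.2] at h1
      have h2 := Finset.card_le_card hA.1
      omega
  · obtain ⟨I, hIX, hIt, hI⟩ := exists_initial_segment X (t + 1) ht
    -- A set with at most one point in the initial segment `I` misses one of two disjoint halves of
    -- it. The union bound over the halves costs a factor 2 and avoids the exact law.
    obtain ⟨J, hJI, hJ⟩ := Finset.exists_subset_card_eq (s := I) (n := (t + 1) / 2) (by omega)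
    obtain ⟨J', hJI', hJ'⟩ := Finset.exists_subset_card_eq (s := I \ J) (n := (t + 1) / 2) (by
      rw [Finset.card_sdiff_of_subset hJI]; omega)
    have h1 := card_powersetCard_disjoint_mul_pow_le (hJI.trans hIX) k
    have h2 := card_powersetCard_disjoint_mul_pow_le
      ((hJI'.trans Finset.sdiff_subset).trans hIX) k
    rw [hJ] at h1
    rw [hJ'] at h2
    have hsub : ((X.powersetCard k).filter fun A => t ≤ (belowSecond A (X \ A)).card) ⊆
        ((X.powersetCard k).filter fun A => Disjoint A J) ∪
          ((X.powersetCard k).filter fun A => Disjoint A J') := by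
      intro A hA
      rw [Finset.mem_filter] at hA
      have hA' := Finset.mem_powersetCard.1 hA.1
      rw [Finset.mem_union, Finset.mem_filter, Finset.mem_filter]
      by_contra hcon
      have hnd : ¬ Disjoint A J ∧ ¬ Disjoint A J' := by tauto
      obtain ⟨⟨y, hyA, hyJ⟩, ⟨y', hyA', hyJ'⟩⟩ := hnd.imp Finset.not_disjoint_iff.1
        Finset.not_disjoint_iff.1
      have hle := card_inter_le_one_of_le_card_belowSecond hA'.1
        (Finset.card_pos.1 (by omega)) hIX hI (by omega)
      have hyy := Finset.mem_sdiff.1 (hJI' hyJ')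
      have heq := Finset.card_le_one.1 hle y (Finset.mem_inter.2 ⟨hyA, hJI hyJ⟩) y'
        (Finset.mem_inter.2 ⟨hyA', hyy.1⟩)
      exact hyy.2 (heq ▸ hyJ)
    have h3 := (Finset.card_le_card hsub).trans (Finset.card_union_le _ _)
    calc _ ≤ (((X.powersetCard k).filter fun A => Disjoint A J).card +
          ((X.powersetCard k).filter fun A => Disjoint A J').card) *
          X.card ^ ((t + 1) / 2) := by gcongr
      _ ≤ _ := by rw [add_mul, two_mul]; exact add_le_add h1 h2

/-- With `k` at least half of `X.card`, every missed element costs a factor 1/2; there is one for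
every two steps of `t`, and `√(1/2) ≤ 3/4`. -/
theorem card_belowSecond_tail_geometric (X : Finset α) {k : ℕ} (hk : 1 ≤ k)
    (hX : X.card ≤ 2 * k) (hkX : k ≤ X.card) (t : ℕ) :
    (((X.powersetCard k).filter fun A => t ≤ (belowSecond A (X \ A)).card).card : ℝ) ≤
      2 * (3 / 4) ^ t * X.card.choose k := by
  have h1 := card_belowSecond_tail X hk t
  set N := ((X.powersetCard k).filter fun A => t ≤ (belowSecond A (X \ A)).card).card
  set i := (t + 1) / 2 with hi
  have hpos : 0 < X.card ^ i := pow_pos (by omega) i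
  have h2 : N * 2 ^ i ≤ 2 * X.card.choose k := by
    refine Nat.le_of_mul_le_mul_right ?_ hpos
    calc N * 2 ^ i * X.card ^ i = 2 ^ i * (N * X.card ^ i) := by ring
      _ ≤ 2 ^ i * (2 * ((X.card - k) ^ i * X.card.choose k)) := by gcongr
      _ = 2 * X.card.choose k * (2 * (X.card - k)) ^ i := by rw [mul_pow]; ring
      _ ≤ 2 * X.card.choose k * X.card ^ i := by
        gcongr
        omega
  have h3 : (N : ℝ) * 2 ^ i ≤ 2 * X.card.choose k := by exact_mod_cast h2
  have h4 : (1 / 2 : ℝ) ^ i ≤ (3 / 4) ^ t := by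
    calc (1 / 2 : ℝ) ^ i ≤ ((3 / 4) ^ 2) ^ i := by gcongr; norm_num
      _ = (3 / 4) ^ (2 * i) := by rw [pow_mul]
      _ ≤ (3 / 4) ^ t := pow_le_pow_of_le_one (by norm_num) (by norm_num) (by omega)
  calc (N : ℝ) = N * 2 ^ i * (1 / 2) ^ i := by
        rw [mul_assoc, ← mul_pow]; norm_num
    _ ≤ 2 * X.card.choose k * (3 / 4) ^ t := by gcongr
    _ = _ := by ring

/-- Summation over the tail `2 * (3/4) ^ t`: the base 5/4 leaves the ratio 15/16, whose geometric
series is 16. -/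
theorem sum_five_quarters_pow_le (X : Finset α) {k : ℕ} (hk : 1 ≤ k)
    (hX : X.card ≤ 2 * k) (hkX : k ≤ X.card) :
    ∑ A ∈ X.powersetCard k, (5 / 4 : ℝ) ^ (belowSecond A (X \ A)).card ≤
      32 * (X.powersetCard k).card := by
  have hmaps : ∀ A ∈ X.powersetCard k,
      (belowSecond A (X \ A)).card ∈ Finset.range (X.card + 1) := fun A _ =>
    Finset.mem_range.2 (Nat.lt_succ_of_le (Finset.card_le_card
      ((belowSecond_subset _ _).trans Finset.sdiff_subset)))
  rw [← Finset.sum_fiberwise_of_maps_to hmaps, Finset.card_powersetCard]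
  have hgeom : ∑ t ∈ Finset.range (X.card + 1), (15 / 16 : ℝ) ^ t ≤ 16 := by
    rw [geom_sum_eq (by norm_num), div_le_iff_of_neg (by norm_num)]
    have : (0 : ℝ) ≤ (15 / 16) ^ (X.card + 1) := by positivity
    linarith
  calc _ ≤ ∑ t ∈ Finset.range (X.card + 1),
        2 * (X.card.choose k : ℝ) * (15 / 16) ^ t := by
        refine Finset.sum_le_sum fun t _ => ?_
        have h1 : ∀ A ∈ (X.powersetCard k).filter
            (fun A => (belowSecond A (X \ A)).card = t),
            (5 / 4 : ℝ) ^ (belowSecond A (X \ A)).card = (5 / 4) ^ t := fun A hA => by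
          rw [(Finset.mem_filter.1 hA).2]
        rw [Finset.sum_congr rfl h1, Finset.sum_const, nsmul_eq_mul]
        have h2 : (((X.powersetCard k).filter
            fun A => (belowSecond A (X \ A)).card = t).card : ℝ) ≤
            2 * (3 / 4) ^ t * X.card.choose k := by
          refine le_trans ?_ (card_belowSecond_tail_geometric X hk hX hkX t)
          exact_mod_cast Finset.card_le_card (Finset.monotone_filter_right _ fun A _ h => Eq.ge h)
        calc _ ≤ 2 * (3 / 4) ^ t * X.card.choose k * (5 / 4 : ℝ) ^ t := by gcongr
          _ = 2 * (X.card.choose k : ℝ) * ((3 / 4) * (5 / 4)) ^ t := by rw [mul_pow]; ring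
          _ = _ := by norm_num
    _ ≤ 2 * (X.card.choose k : ℝ) * 16 := by
        rw [← Finset.mul_sum]
        gcongr
    _ = _ := by ring

/-- One term of the exponential series at `t / 8`, with `exp (1/8) ≤ 5/4`. It converts the
exponential moment of `|C|` into its `p`-th moment. -/
theorem two_mul_pow_le_factorial_mul (p t : ℕ) :
    (2 * t : ℝ) ^ p ≤ 16 ^ p * p.factorial * (5 / 4) ^ t := by
  have h1 := Real.pow_div_factorial_le_exp (t / 8 : ℝ) (by positivity) p
  have h2 : Real.exp (1 / 8) ≤ 5 / 4 := by
    refine le_of_pow_le_pow_left₀ (n := 8) (by norm_num) (by norm_num) ?_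
    rw [← Real.exp_nat_mul]
    have := Real.exp_one_lt_d9
    norm_num at this ⊢
    linarith
  have h3 : Real.exp (t / 8) ≤ (5 / 4) ^ t := by
    calc Real.exp (t / 8) = Real.exp (1 / 8) ^ t := by
          rw [← Real.exp_nat_mul]; congr 1; ring
      _ ≤ _ := by gcongr
  rw [div_le_iff₀ (by positivity)] at h1
  calc (2 * t : ℝ) ^ p = 16 ^ p * (t / 8 : ℝ) ^ p := by rw [← mul_pow]; congr 1; ring
    _ ≤ 16 ^ p * (Real.exp (t / 8) * p.factorial) := by gcongr
    _ ≤ 16 ^ p * ((5 / 4) ^ t * p.factorial) := by gcongr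
    _ = _ := by ring

theorem sum_card_belowSecond_pow_le (X : Finset α) {k : ℕ} (hk : 1 ≤ k)
    (hX : X.card ≤ 2 * k) (hkX : k ≤ X.card) (p : ℕ) :
    ∑ A ∈ X.powersetCard k, (2 * (belowSecond A (X \ A)).card : ℝ) ^ p ≤
      16 ^ p * p.factorial * 32 * (X.powersetCard k).card := by
  calc _ ≤ ∑ A ∈ X.powersetCard k, 16 ^ p * p.factorial *
        (5 / 4 : ℝ) ^ (belowSecond A (X \ A)).card :=
        Finset.sum_le_sum fun A _ => two_mul_pow_le_factorial_mul p _
    _ ≤ _ := by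
        rw [← Finset.mul_sum, mul_assoc _ (32 : ℝ)]
        gcongr
        exact sum_five_quarters_pow_le X hk hX hkX

theorem card_belowSecond_tail_exp (X : Finset α) {k : ℕ} (hk : 1 ≤ k) (hkX : k ≤ X.card) :
    (((X.powersetCard k).filter fun A => k < (belowSecond A (X \ A)).card).card : ℝ) ≤
      2 * Real.exp (-(k * (k + 1) / (2 * X.card))) * (X.powersetCard k).card := by
  -- The strict inequality `k < |C|` is the tail at `t = k + 1`, so the exponent is at least `(k +
  -- 1) / 2`.
  have h1 := card_belowSecond_tail X hk (k + 1)
  rw [Finset.card_powersetCard]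
  set i := (k + 1 + 1) / 2 with hi
  change (_ : ℕ) ≤ _ at h1
  have h1' : (((X.powersetCard k).filter
      fun A => k < (belowSecond A (X \ A)).card).card : ℝ) * (X.card : ℝ) ^ i ≤
      2 * (((X.card : ℝ) - k) ^ i * X.card.choose k) := by
    rw [← Nat.cast_sub hkX]
    exact_mod_cast h1
  have hpos : (0 : ℝ) < X.card := by exact_mod_cast (by omega : 0 < X.card)
  have hkX' : (k : ℝ) ≤ X.card := by exact_mod_cast hkX
  have hi' : ((k : ℝ) + 1) / 2 ≤ i := by
    have : k + 1 ≤ 2 * i := by omega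
    have : (k : ℝ) + 1 ≤ 2 * i := by exact_mod_cast this
    linarith
  have h2 : ((X.card : ℝ) - k) ^ i ≤
      (X.card : ℝ) ^ i * Real.exp (-(k * (k + 1) / (2 * X.card))) := by
    have h3 : (X.card : ℝ) - k ≤ X.card * Real.exp (-(k / X.card)) := by
      have := Real.add_one_le_exp (-(k / X.card : ℝ))
      calc (X.card : ℝ) - k = X.card * (-(k / X.card) + 1) := by field_simp; ring
        _ ≤ _ := by gcongr
    calc ((X.card : ℝ) - k) ^ i ≤ (X.card * Real.exp (-(k / X.card))) ^ i := by
          gcongr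
      _ = (X.card : ℝ) ^ i * Real.exp (i * -(k / X.card)) := by
          rw [mul_pow, ← Real.exp_nat_mul]
      _ ≤ _ := by
          gcongr
          have h4 : (k : ℝ) * (k + 1) / (2 * X.card) = ((k + 1) / 2) * (k / X.card) := by
            field_simp
          rw [h4, mul_neg, neg_le_neg_iff]
          gcongr
  refine le_of_mul_le_mul_right (h1'.trans ?_) (pow_pos hpos i)
  calc _ ≤ 2 * ((X.card : ℝ) ^ i * Real.exp (-(k * (k + 1) / (2 * X.card))) *
        X.card.choose k) := by gcongr
    _ = _ := by ring

/-- The probability is `⌈n / 2⌉ / n`, which for `n > 8` is largest at `n = 9`. -/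
theorem card_powersetCard_mem_le {X : Finset α} {e : α} (he : e ∈ X) (hX : 8 < X.card) :
    (((X.powersetCard ((X.card + 1) / 2)).filter fun A => e ∈ A).card : ℝ) ≤
      5 / 9 * (X.powersetCard ((X.card + 1) / 2)).card := by
  set k := (X.card + 1) / 2 with hk
  have h1 : ((X.powersetCard k).filter fun A => e ∉ A) = (X.erase e).powersetCard k := by
    ext A
    simp only [Finset.mem_filter, Finset.mem_powersetCard, Finset.subset_erase]
    tauto
  have h2 := Finset.card_filter_add_card_filter_not (s := X.powersetCard k) (fun A => e ∈ A)
  rw [h1] at h2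
  simp only [Finset.card_powersetCard, Finset.card_erase_of_mem he] at h2 ⊢
  obtain ⟨m, hm⟩ : ∃ m, X.card = m + 1 := ⟨X.card - 1, by omega⟩
  have h3 := Nat.choose_mul_succ_eq m k
  rw [← hm] at h3
  have h4 : 4 * X.card ≤ 9 * (X.card - k) := by omega
  have h5 : X.card - 1 = m := by omega
  rw [h5] at h2
  have h6 : X.card * (4 * X.card.choose k) ≤ X.card * (9 * m.choose k) := by nlinarith
  have h7 := Nat.le_of_mul_le_mul_left h6 (by omega)
  have h2' : ((((X.powersetCard k).filter fun A => e ∈ A).card : ℕ) : ℝ) + m.choose k =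
    X.card.choose k := by exact_mod_cast h2
  have h7' : (4 : ℝ) * X.card.choose k ≤ 9 * m.choose k := by exact_mod_cast h7
  linarith

end Subsets

/-! ### Bounds for the minimum in SampleMinimum -/

theorem two_pow_clog_le {m : ℕ} (hm : 1 ≤ m) : 2 ^ Nat.clog 2 m ≤ 2 * m := by
  rcases hm.eq_or_lt with rfl | hm
  · simp
  · have h1 := Nat.pow_pred_clog_lt_self one_lt_two hm
    have h2 := Nat.clog_pos one_lt_two hm
    obtain ⟨c, hc⟩ := Nat.exists_eq_add_of_le' h2
    rw [hc] at h1 ⊢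
    simp only [Nat.pred_eq_sub_one, Nat.add_sub_cancel] at h1
    rw [pow_succ]
    omega

/-- A logarithmic cost contributes only a polynomial in the size, so a `p`-th moment controls the
generating function up to `2 ^ p`. -/
theorem pow_clog_le {ζ : ℝ} {p m : ℕ} (h0 : 0 ≤ ζ) (hp : ζ ≤ 2 ^ p) (hm : 1 ≤ m) :
    ζ ^ Nat.clog 2 m ≤ (2 * m : ℝ) ^ p := by
  calc ζ ^ Nat.clog 2 m ≤ (2 ^ p) ^ Nat.clog 2 m := by gcongr
    _ = (2 ^ Nat.clog 2 m) ^ p := by rw [← pow_mul, ← pow_mul, mul_comm]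
    _ ≤ (2 * m : ℝ) ^ p := by
        gcongr
        exact_mod_cast two_pow_clog_le hm

/-- `k = ⌊n ^ (2 / 3)⌋` is large compared with `√n` as soon as `n` is large. -/
theorem five_mul_le_of_pow_lt {p n k : ℕ} (hp : 1 ≤ p) (hn : 512 * p ^ 3 < n)
    (hk : n ^ 2 < (k + 1) ^ 3) : 5 * p * (n + 1) ≤ k * (k + 1) := by
  have h1 : 64 * p ^ 2 < k + 1 := by
    refine lt_of_pow_lt_pow_left₀ 3 (Nat.zero_le _) (lt_trans ?_ hk)
    calc (64 * p ^ 2) ^ 3 = (512 * p ^ 3) ^ 2 := by ring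
      _ < n ^ 2 := Nat.pow_lt_pow_left hn (by norm_num)
  have hp2 : 1 ≤ p ^ 2 := Nat.one_le_pow _ _ hp
  have hp3 : 1 ≤ p ^ 3 := Nat.one_le_pow _ _ hp
  refine le_of_pow_le_pow_left₀ two_ne_zero (Nat.zero_le _) ?_
  calc (5 * p * (n + 1)) ^ 2 ≤ (6 * p * n) ^ 2 := by
        refine Nat.pow_le_pow_left ?_ 2
        have h2 : p * 5 ≤ p * n := Nat.mul_le_mul_left p (by omega)
        nlinarith
    _ = 36 * p ^ 2 * n ^ 2 := by ring
    _ ≤ 36 * p ^ 2 * (k + 1) ^ 3 := by gcongr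
    _ ≤ (k * (k + 1)) ^ 2 := by
        have h3 : 36 * p ^ 2 * (k + 1) ≤ k ^ 2 := by nlinarith
        calc 36 * p ^ 2 * (k + 1) ^ 3 = 36 * p ^ 2 * (k + 1) * (k + 1) ^ 2 := by ring
          _ ≤ k ^ 2 * (k + 1) ^ 2 := by gcongr
          _ = _ := by ring

section SampleMinimum
variable {α : Type u} [LinearOrder α]

theorem mem_belowSecond_of_min {S T : Finset α} {e : α} (heT : e ∈ T) (hST : Disjoint S T)
    (hmin : ∀ x ∈ S, e ≤ x) : e ∈ belowSecond S T := by
  refine Finset.mem_filter.2 ⟨heT, ?_⟩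
  rw [Finset.filter_false_of_mem, Finset.card_empty]
  · exact Nat.zero_le _
  · intro x hx hxe
    exact Finset.disjoint_left.1 hST hx (le_antisymm hxe (hmin x hx) ▸ heT)

theorem mgf_sampleMinimum_le_pow_clog {X : Finset α} {e : α} {ζ : ℝ} (hζ : 1 ≤ ζ)
    (hmin : ∀ x ∈ X, e ≤ x) :
    (sampleMinimum X).mgf (ENNReal.ofReal ζ) e ≤ ENNReal.ofReal (ζ ^ (4 * Nat.clog 2 X.card)) := by
  have hz : 1 ≤ ENNReal.ofReal ζ := ENNReal.one_le_ofReal.2 hζ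
  rw [ENNReal.ofReal_pow (by linarith)]
  exact ((yields_sampleMinimum X).mgf_le hz e).trans (pow_le_pow_right₀ hz (minCost_le hmin _))

/-- One level of the recursion with the inner average left open as `V`: the term with 5/9 is the
case `e ∈ A`, and the other one comes from the `p`-th moment of `2 * |C|`. -/
theorem mgf_sampleMinimum_step {X : Finset α} {e : α} {ζ V : ℝ} {p : ℕ} (hX : 8 < X.card)
    (hζ : 1 ≤ ζ) (hp : ζ ≤ 2 ^ p) (he : e ∈ X) (hmin : ∀ x ∈ X, e ≤ x) (hV : 0 ≤ V)
    (h : ∀ A ∈ X.powersetCard ((X.card + 1) / 2), e ∈ A →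
      Comp.mean (A.powersetCard ⌊(X.card : ℝ) ^ (2 / 3 : ℝ)⌋₊) (fun B =>
        if e ∈ B then (sampleMinimum B).mgf (ENNReal.ofReal ζ) e
        else (sampleMinimum (belowSecond B (A \ B))).mgf (ENNReal.ofReal ζ) e) ≤
      ENNReal.ofReal V) :
    (sampleMinimum X).mgf (ENNReal.ofReal ζ) e ≤
      ENNReal.ofReal (5 / 9 * (ζ ^ 4 * V) + ζ ^ 2 * (16 ^ p * p.factorial * 32)) := by
  have h0 : 0 ≤ ζ := by linarith
  refine (mgf_sampleMinimum_le hX (ENNReal.one_le_ofReal.2 hζ) he hmin).trans ?_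
  -- The moment term is kept also when `e ∈ A`; this only loses, and its sum then runs over all `A`.
  refine Comp.mean_le_ofReal (g' := fun A => (if e ∈ A then ζ ^ 4 * V else 0) +
    ζ ^ 2 * (2 * (belowSecond A (X \ A)).card : ℝ) ^ p)
    (Finset.powersetCard_nonempty.2 (by omega)) ?_ ?_ ?_
  · intro A hA
    by_cases heA : e ∈ A
    · rw [if_pos heA, if_pos heA, ← ENNReal.ofReal_pow h0]
      refine (mul_le_mul_right (h A hA heA) _).trans ?_
      rw [← ENNReal.ofReal_mul (by positivity)]
      exact ENNReal.ofReal_le_ofReal (le_add_of_nonneg_right (by positivity))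
    · rw [if_neg heA, if_neg heA, ← ENNReal.ofReal_pow h0, zero_add, pow_add]
      have heC := mem_belowSecond_of_min (S := A) (Finset.mem_sdiff.2 ⟨he, heA⟩)
        Finset.disjoint_sdiff fun x hx => hmin x ((Finset.mem_powersetCard.1 hA).1 hx)
      refine ENNReal.ofReal_le_ofReal (mul_le_mul_of_nonneg_left
        (pow_clog_le h0 hp (Finset.card_pos.2 ⟨e, heC⟩)) (by positivity))
  · intro A _
    have : 0 ≤ ζ ^ 4 * V := by positivity
    split_ifs <;> positivity
  · rw [Finset.sum_add_distrib, ← Finset.mul_sum, ← Finset.sum_filter, Finset.sum_const,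
      nsmul_eq_mul, add_mul]
    have h1 := card_powersetCard_mem_le he hX
    have h2 := sum_card_belowSecond_pow_le X (k := (X.card + 1) / 2) (by omega) (by omega)
      (by omega) p
    refine add_le_add ?_ ?_
    · calc _ ≤ 5 / 9 * ((X.powersetCard ((X.card + 1) / 2)).card : ℝ) * (ζ ^ 4 * V) := by gcongr
        _ = _ := by ring
    · rw [mul_assoc]
      gcongr

/-- A moment generating function of the comparisons of the minimum is bounded uniformly. -/
theorem mgf_sampleMinimum_le_const (X : Finset α) (e : α) (he : e ∈ X) (hmin : ∀ x ∈ X, e ≤ x) :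
    (sampleMinimum X).mgf (ENNReal.ofReal (21 / 20)) e ≤ ENNReal.ofReal 2000 := by
  induction hn : X.card using Nat.strong_induction_on generalizing X with
  | _ n ih =>
    subst hn
    by_cases h : X.card ≤ 8
    · refine (mgf_sampleMinimum_le_pow_clog (by norm_num) hmin).trans (ENNReal.ofReal_le_ofReal ?_)
      have h1 : Nat.clog 2 X.card ≤ 3 := Nat.clog_le_of_le_pow (by omega)
      calc (21 / 20 : ℝ) ^ (4 * Nat.clog 2 X.card) ≤ (21 / 20) ^ (4 * 3) := by
            gcongr
            norm_num
        _ ≤ 2000 := by norm_num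
    · have hk := floor_rpow_two_thirds_le (not_le.1 h)
      -- The value 2000 reproduces itself: `5/9 * (21/20)^4 * 2000 + (21/20)^2 * 512 < 2000`. No
      -- size estimate for `D` is needed, as `B` and `D` are both smaller than `X`.
      refine (mgf_sampleMinimum_step (V := 2000) (p := 1) (not_le.1 h) (by norm_num) (by norm_num)
        he hmin (by norm_num) fun A hA heA => Comp.mean_const_le fun B hB => ?_).trans
        (ENNReal.ofReal_le_ofReal ?_)
      · rw [Finset.mem_powersetCard] at hA hB
        split_ifs with heB
        · exact ih B.card (by omega) B heB (fun x hx => hmin x (hA.1 (hB.1 hx))) rfl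
        · have hsub := (belowSecond_subset B (A \ B)).trans Finset.sdiff_subset
          refine ih _ ?_ _ (mem_belowSecond_of_min (Finset.mem_sdiff.2 ⟨heA, heB⟩)
            Finset.disjoint_sdiff fun x hx => hmin x (hA.1 (hB.1 hx)))
            (fun x hx => hmin x (hA.1 (hsub hx))) rfl
          have := Finset.card_le_card hsub
          omega
      · norm_num

/-- The bound on the generating function at `2 ^ p` for the minimum of small sets. -/
def mgfBase (p : ℕ) : ℝ := (1024 * p ^ 3) ^ (4 * p)

theorem factorial_le_mgfBase {p : ℕ} (hp : 1 ≤ p) : 16 ^ p * p.factorial * 4 ≤ mgfBase p := by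
  have h1 : p.factorial ≤ p ^ p := Nat.factorial_le_pow p
  have h2 : 4 ≤ 4 ^ p := Nat.le_self_pow (by omega) 4
  have hp3 : p ≤ p ^ 3 := Nat.le_self_pow (by norm_num) p
  have h3 : 16 ^ p * p.factorial * 4 ≤ (1024 * p ^ 3) ^ (4 * p) := by
    calc 16 ^ p * p.factorial * 4 ≤ 16 ^ p * p ^ p * 4 ^ p := by gcongr
      _ = (64 * p) ^ p := by rw [← mul_pow, ← mul_pow]; congr 1; ring
      _ ≤ (1024 * p ^ 3) ^ p := by gcongr; norm_num
      _ ≤ (1024 * p ^ 3) ^ (4 * p) := Nat.pow_le_pow_right (by positivity) (by omega)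
  unfold mgfBase
  exact_mod_cast h3

theorem mgf_sampleMinimum_le_growth {p : ℕ} (hp : 1 ≤ p) (j : ℕ) :
    ∀ (X : Finset α) (e : α), e ∈ X → (∀ x ∈ X, e ≤ x) →
      Real.log X.card ≤ (3 / 2) ^ j * Real.log (512 * p ^ 3) →
      (sampleMinimum X).mgf (ENNReal.ofReal (2 ^ p)) e ≤
        ENNReal.ofReal (mgfBase p * (2 ^ p) ^ (6 * j)) := by
  have hp1 : (1 : ℝ) ≤ p := by exact_mod_cast hp
  have hz1 : (1 : ℝ) ≤ 2 ^ p := one_le_pow₀ one_le_two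
  have hz2 : (2 : ℝ) ≤ 2 ^ p := by
    simpa using pow_le_pow_right₀ (one_le_two : (1 : ℝ) ≤ 2) hp
  have hW : 0 < mgfBase p := by unfold mgfBase; positivity
  -- Below the size `512 * p ^ 3` the worst case of `4 * Nat.clog 2 X.card` comparisons is used; it
  -- contributes `(2 * X.card) ^ (4 * p)`.
  have small : ∀ (j : ℕ) (X : Finset α) (e : α), e ∈ X → (∀ x ∈ X, e ≤ x) →
      X.card ≤ 512 * p ^ 3 → (sampleMinimum X).mgf (ENNReal.ofReal (2 ^ p)) e ≤
        ENNReal.ofReal (mgfBase p * (2 ^ p) ^ (6 * j)) := by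
    intro j X e he hmin hX
    refine (mgf_sampleMinimum_le_pow_clog hz1 hmin).trans (ENNReal.ofReal_le_ofReal ?_)
    have hX' : (X.card : ℝ) ≤ 512 * p ^ 3 := by exact_mod_cast hX
    have h1 : (2 * X.card : ℝ) ≤ 1024 * p ^ 3 := by linarith
    calc ((2 : ℝ) ^ p) ^ (4 * Nat.clog 2 X.card) = ((2 ^ p) ^ Nat.clog 2 X.card) ^ 4 := by
          rw [← pow_mul _ _ 4, mul_comm 4]
      _ ≤ ((2 * X.card : ℝ) ^ p) ^ 4 := by
          gcongr
          exact pow_clog_le (by positivity) le_rfl (Finset.card_pos.2 ⟨e, he⟩)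
      _ = (2 * X.card : ℝ) ^ (4 * p) := by rw [← pow_mul, mul_comm 4]
      _ ≤ mgfBase p := by unfold mgfBase; gcongr
      _ ≤ mgfBase p * (2 ^ p) ^ (6 * j) := le_mul_of_one_le_right hW.le (one_le_pow₀ hz1)
  induction j with
  | zero =>
    intro X e he hmin hX
    refine small 0 X e he hmin ?_
    rw [pow_zero, one_mul, Real.log_le_log_iff (by exact_mod_cast Finset.card_pos.2 ⟨e, he⟩)
      (by positivity)] at hX
    exact_mod_cast hX
  | succ j ihj =>
    intro X
    induction hn : X.card using Nat.strong_induction_on generalizing X with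
    | _ n ih =>
      subst hn
      intro e he hmin hX
      by_cases hsmall : X.card ≤ 512 * p ^ 3
      · exact small _ X e he hmin hsmall
      have hp3 : 1 ≤ p ^ 3 := Nat.one_le_pow _ _ hp
      have h8 : 8 < X.card := by omega
      have hka := floor_rpow_two_thirds_le h8
      have hk2 := two_le_floor_rpow_two_thirds h8
      have hkle := floor_rpow_two_thirds_pow_le X.card
      have hklt := lt_floor_rpow_two_thirds_succ_pow X.card
      set k := ⌊(X.card : ℝ) ^ (2 / 3 : ℝ)⌋₊ with hk
      set W := mgfBase p * (2 ^ p) ^ (6 * j) with hWj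
      set W' := mgfBase p * (2 ^ p) ^ (6 * (j + 1)) with hWj'
      set δ := 2 * Real.exp (-(5 * p : ℝ)) with hδ
      have hWpos : 0 < W := by positivity
      have hWpos' : 0 < W' := by positivity
      have hWW : W' = W * (2 ^ p) ^ 6 := by
        rw [hWj, hWj', mul_add, pow_add, mul_one, mul_assoc]
      -- Since `k ^ 3 ≤ X.card ^ 2`, passing to a set of at most `k` elements multiplies the
      -- logarithm of the size by at most 2/3, which lowers `j` by one.
      have hlogk : ∀ m : ℕ, 1 ≤ m → m ≤ k →
          Real.log m ≤ (3 / 2) ^ j * Real.log (512 * p ^ 3) := by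
        intro m hm hmk
        have hm0 : (0 : ℝ) < m := by exact_mod_cast hm
        have h1 : (m : ℝ) ^ 3 ≤ (X.card : ℝ) ^ 2 := by
          exact_mod_cast (Nat.pow_le_pow_left hmk 3).trans hkle
        have h2 := Real.log_le_log (by positivity) h1
        rw [Real.log_pow, Real.log_pow] at h2
        rw [pow_succ] at hX
        push_cast at h2
        linarith
      -- `W` covers `B` and every `D` with at most `k` elements. A larger `D` has probability at
      -- most `δ`; it keeps the level `j + 1`, and the inner induction on the size supplies `W'`.
      refine (mgf_sampleMinimum_step (V := W + δ * W') h8 hz1 le_rfl he hmin (by positivity)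
        fun A hA heA => ?_).trans (ENNReal.ofReal_le_ofReal ?_)
      · rw [Finset.mem_powersetCard] at hA
        refine Comp.mean_le_ofReal (g' := fun B => W +
          if k < (belowSecond B (A \ B)).card then W' else 0)
          (Finset.powersetCard_nonempty.2 (by omega)) ?_ ?_ ?_
        · intro B hB
          rw [Finset.mem_powersetCard] at hB
          have hminB : ∀ x ∈ B, e ≤ x := fun x hx => hmin x (hA.1 (hB.1 hx))
          split_ifs with heB hD hD
          · refine (ihj B e heB hminB (hlogk _ (by omega) hB.2.le)).trans
              (ENNReal.ofReal_le_ofReal (by linarith))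
          · refine (ihj B e heB hminB (hlogk _ (by omega) hB.2.le)).trans
              (ENNReal.ofReal_le_ofReal (by linarith))
          all_goals
            have hsub := (belowSecond_subset B (A \ B)).trans Finset.sdiff_subset
            have heD := mem_belowSecond_of_min (S := B) (Finset.mem_sdiff.2 ⟨heA, heB⟩)
              Finset.disjoint_sdiff hminB
            have hDpos := Finset.card_pos.2 ⟨e, heD⟩
            have hDmin : ∀ x ∈ belowSecond B (A \ B), e ≤ x := fun x hx => hmin x (hA.1 (hsub hx))
          · have hDX := Finset.card_le_card hsub
            refine (ih (belowSecond B (A \ B)).card (by omega) _ rfl e heD hDmin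
              (le_trans ?_ hX)).trans (ENNReal.ofReal_le_ofReal (by linarith))
            refine Real.log_le_log (by exact_mod_cast hDpos) ?_
            exact_mod_cast (by omega : (belowSecond B (A \ B)).card ≤ X.card)
          · refine (ihj _ e heD hDmin (hlogk _ hDpos (not_lt.1 hD))).trans
              (ENNReal.ofReal_le_ofReal (by linarith))
        · intro B _
          split_ifs <;> positivity
        · rw [Finset.sum_add_distrib, Finset.sum_const, ← Finset.sum_filter, Finset.sum_const,
            nsmul_eq_mul, nsmul_eq_mul, add_mul]
          refine add_le_add (mul_comm _ _).le ?_
          have h1 := card_belowSecond_tail_exp A (k := k) (by omega) (by omega)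
          have h2 : Real.exp (-(k * (k + 1) / (2 * A.card))) ≤ Real.exp (-(5 * p : ℝ)) := by
            -- Here `X.card > 512 * p ^ 3` enters: `k ^ 2 / |X|` exceeds a multiple of `p`, making
            -- the failure probability small enough to beat `(2 ^ p) ^ 4`.
            have h3 := five_mul_le_of_pow_lt hp (not_le.1 hsmall) hklt
            have h4 : 2 * A.card ≤ X.card + 1 := by omega
            have h5 : 5 * p * (2 * A.card) ≤ k * (k + 1) :=
              (Nat.mul_le_mul_left _ h4).trans h3
            have h6 : (5 * p : ℝ) * (2 * A.card) ≤ k * (k + 1) := by exact_mod_cast h5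
            have h7 : (0 : ℝ) < 2 * A.card := by exact_mod_cast (by omega : 0 < 2 * A.card)
            refine Real.exp_le_exp.2 (neg_le_neg ?_)
            rwa [le_div_iff₀ h7]
          calc _ ≤ 2 * Real.exp (-(k * (k + 1) / (2 * A.card))) *
                ((A.powersetCard k).card : ℝ) * W' := by gcongr
            _ ≤ 2 * Real.exp (-(5 * p : ℝ)) * ((A.powersetCard k).card : ℝ) * W' := by gcongr
            _ = _ := by rw [hδ]; ring
      · have hz4 : (16 : ℝ) ≤ (2 ^ p) ^ 4 := by
          calc (16 : ℝ) = 2 ^ 4 := by norm_num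
            _ ≤ _ := by gcongr
        have hz2' : (4 : ℝ) ≤ (2 ^ p) ^ 2 := by
          calc (4 : ℝ) = 2 ^ 2 := by norm_num
            _ ≤ _ := by gcongr
        have h1 : (2 ^ p) ^ 4 * W ≤ W' / 4 := by
          have : (2 ^ p) ^ 4 * W * 4 ≤ (2 ^ p) ^ 4 * W * (2 ^ p) ^ 2 := by gcongr
          have h3 : W' = (2 ^ p) ^ 4 * W * (2 ^ p) ^ 2 := by rw [hWW]; ring
          linarith
        have h2 : (2 ^ p) ^ 4 * δ ≤ 1 / 4 := by
          have h3 : (128 : ℝ) ^ p ≤ Real.exp (5 * p) := by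
            have h4 : (128 : ℝ) ≤ Real.exp 1 ^ 5 := by
              calc (128 : ℝ) ≤ 2.7 ^ 5 := by norm_num
                _ ≤ Real.exp 1 ^ 5 := by
                  have := Real.exp_one_gt_d9
                  gcongr
                  linarith
            calc (128 : ℝ) ^ p ≤ (Real.exp 1 ^ 5) ^ p := by gcongr
              _ = Real.exp (5 * p) := by
                rw [← pow_mul, ← Real.exp_nat_mul]; congr 1; push_cast; ring
          have h5 : (8 : ℝ) ≤ 8 ^ p := by
            simpa using pow_le_pow_right₀ (by norm_num : (1 : ℝ) ≤ 8) hp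
          have h6 : (2 ^ p) ^ 4 * 8 ≤ Real.exp (5 * p) := by
            calc ((2 : ℝ) ^ p) ^ 4 * 8 ≤ (2 ^ p) ^ 4 * 8 ^ p := by gcongr
              _ = 128 ^ p := by
                rw [← pow_mul, mul_comm p 4, pow_mul, ← mul_pow]; norm_num
              _ ≤ _ := h3
          have h7 : Real.exp (5 * p) * Real.exp (-(5 * p)) = 1 := by
            rw [← Real.exp_add, add_neg_cancel, Real.exp_zero]
          have h8 := mul_le_mul_of_nonneg_right h6 (Real.exp_pos (-(5 * p : ℝ))).le
          rw [h7] at h8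
          rw [hδ]
          linarith
        have h3 : ((2 : ℝ) ^ p) ^ 2 * (16 ^ p * p.factorial * 32) ≤ W' / 2 := by
          have h4 := factorial_le_mgfBase hp
          have h5 : mgfBase p ≤ W := le_mul_of_one_le_right hW.le (one_le_pow₀ hz1)
          have h6 : (2 ^ p) ^ 2 * (16 ^ p * p.factorial * 4) ≤ (2 ^ p) ^ 2 * W := by
            gcongr
            exact h4.trans h5
          have h7 : (2 ^ p) ^ 2 * W * 16 ≤ (2 ^ p) ^ 2 * W * (2 ^ p) ^ 4 := by gcongr
          have h8 : W' = (2 ^ p) ^ 2 * W * (2 ^ p) ^ 4 := by rw [hWW]; ring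
          linarith
        have h4 : (2 ^ p) ^ 4 * δ * W' ≤ 1 / 4 * W' := by gcongr
        -- The regular and the oversized case each contribute at most `W' / 4` inside the factor
        -- 5/9, and the moment term at most `W' / 2`; the factor `(2 ^ p) ^ 6` between `W` and `W'`
        -- pays for this.
        calc _ = 5 / 9 * ((2 ^ p) ^ 4 * W + (2 ^ p) ^ 4 * δ * W') +
              (2 ^ p) ^ 2 * (16 ^ p * p.factorial * 32) := by ring
          _ ≤ W' := by linarith

end SampleMinimum

/-! ### TreeMinimum -/

namespace Comp
variable {α β γ : Type u} {ι : Type*}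

theorem exists_yields_mapM' {F : ι → Comp α β} {v : ι → β} (l : List ι)
    (h : ∀ i ∈ l, ∃ κ, (F i).Yields (v i) κ) : ∃ κ, Yields (l.mapM' F) (l.map v) κ := by
  induction l with
  | nil => exact ⟨0, yields_pure _⟩
  | cons i l ih =>
    obtain ⟨κ, hκ⟩ := h i List.mem_cons_self
    obtain ⟨κ', hκ'⟩ := ih fun j hj => h j (List.mem_cons_of_mem _ hj)
    exact ⟨κ + (κ' + 0), hκ.bind (hκ'.bind (yields_pure _))⟩

/-- The subtrees run independently and have fixed results, so the factorization of a single bind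
extends to lists. -/
theorem mgf_mapM' {F : ι → Comp α β} {v : ι → β} (l : List ι)
    (h : ∀ i ∈ l, ∃ κ, (F i).Yields (v i) κ) (z : ℝ≥0∞) (e : α) :
    mgf (l.mapM' F) z e = (l.map fun i => mgf (F i) z e).prod := by
  induction l with
  | nil => exact mgf_pure _ _ _
  | cons i l ih =>
    have hl := fun j hj => h j (List.mem_cons_of_mem i hj)
    obtain ⟨κ, hκ⟩ := h i List.mem_cons_self
    obtain ⟨κ', hκ'⟩ := exists_yields_mapM' l hl
    rw [List.map_cons, List.prod_cons, ← ih hl, List.mapM'_cons, hκ.mgf_bind, hκ'.mgf_bind]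
    exact congrArg _ ((congrArg _ (mgf_pure _ _ _)).trans (mul_one _))

end Comp

theorem injective_subtree {α : Type u} {Δ h : ℕ} {x : (Fin (h + 1) → Fin Δ) → α}
    (hx : Function.Injective x) (i : Fin Δ) :
    Function.Injective fun path : Fin h → Fin Δ => x (Fin.cons i path) :=
  hx.comp (Fin.cons_right_injective _)

section Tree
variable {α : Type u} [LinearOrder α] {Δ : ℕ}

theorem mgf_sampleMinimum_of_notMem {X : Finset α} {e : α} {z : ℝ≥0∞} (hz : 1 ≤ z)
    (he : e ∉ X) : (sampleMinimum X).mgf z e ≤ 1 := by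
  simpa [minCost_of_notMem he] using (yields_sampleMinimum X).mgf_le hz e

theorem mgf_sampleMinimum_le_pow_card (X : Finset α) (e : α) {z : ℝ≥0∞} (hz : 1 ≤ z) :
    (sampleMinimum X).mgf z e ≤ z ^ X.card :=
  ((yields_sampleMinimum X).mgf_le hz e).trans
    (pow_le_pow_right₀ hz ((minCost_le_card _ _ _).trans (Nat.sub_le _ _)))

/-- The set of the minima of the subtrees at the children of the root. -/
noncomputable def childMinima (v : Fin Δ → α) : Finset α :=
  ((List.finRange Δ).map fun i => some (v i)).reduceOption.toFinset

theorem mem_childMinima {v : Fin Δ → α} {a : α} : a ∈ childMinima v ↔ ∃ i, v i = a := by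
  simp [childMinima, List.reduceOption_mem_iff]

theorem card_childMinima {v : Fin Δ → α} (hv : Function.Injective v) :
    (childMinima v).card = Δ := by
  have : childMinima v = Finset.univ.image v := by
    ext a
    simp [mem_childMinima]
  rw [this, Finset.card_image_of_injective _ hv, Finset.card_univ, Fintype.card_fin]

/-- TreeMinimum returns the minimum, and its generating function factors over the tree. -/
theorem treeMinimum_succ {h : ℕ} {x : (Fin (h + 1) → Fin Δ) → α} (hΔ : 2 ≤ Δ)
    (hx : Function.Injective x) {v : Fin Δ → α}
    (hv : ∀ i, IsLeast (Set.range fun path : Fin h → Fin Δ => x (Fin.cons i path)) (v i))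
    (hy : ∀ i, ∃ κ, (treeMinimum Δ h fun path => x (Fin.cons i path)).Yields (some (v i)) κ) :
    (childMinima v).card = Δ ∧
    (∃ e κ, IsLeast (Set.range x) e ∧ (treeMinimum Δ (h + 1) x).Yields (some e) κ) ∧
    ∀ z e, (treeMinimum Δ (h + 1) x).mgf z e =
      (∏ i, (treeMinimum Δ h fun path => x (Fin.cons i path)).mgf z e) *
        (sampleMinimum (childMinima v)).mgf z e := by
  -- The root call must see exactly `Δ` elements: distinct subtrees have disjoint sets of leaf
  -- elements, as the first step of a path can be recovered from its element.
  have hinj : Function.Injective v := by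
    intro i j hij
    obtain ⟨p, hp⟩ := (hv i).1
    obtain ⟨q, hq⟩ := (hv j).1
    have := congrFun (hx (hp.trans (hij.trans hq.symm))) 0
    simpa using this
  have hcard := card_childMinima hinj
  obtain ⟨κ, hκ⟩ := Comp.exists_yields_mapM' (List.finRange Δ)
    (F := fun i => treeMinimum Δ h fun path => x (Fin.cons i path))
    (v := fun i => some (v i)) fun i _ => hy i
  have hS := yields_sampleMinimum (childMinima v)
  refine ⟨hcard, ?_, fun z e => ?_⟩
  · obtain ⟨a, b, hab⟩ := exists_isTwoMin (hcard.symm ▸ hΔ)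
    refine ⟨a, κ + (_ + 0), ⟨?_, ?_⟩, hκ.bind (hS.bind ?_)⟩
    · obtain ⟨i, rfl⟩ := mem_childMinima.1 hab.fst_mem
      obtain ⟨p, hp⟩ := (hv i).1
      exact ⟨_, hp⟩
    · rintro _ ⟨p, rfl⟩
      refine (hab.fst_le (mem_childMinima.2 ⟨p 0, rfl⟩)).trans ((hv (p 0)).2 ⟨Fin.tail p, ?_⟩)
      simp
    · rw [hab.twoMin_eq]
      exact Comp.yields_pure _
  · rw [treeMinimum, hκ.mgf_bind, Comp.mgf_mapM' _ fun i _ => hy i, Fin.prod_univ_def]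
    refine congrArg _ ((hS.mgf_bind z e).trans ?_)
    exact (congrArg _ (Comp.mgf_pure _ _ _)).trans (mul_one _)

theorem exists_yields_treeMinimum (hΔ : 2 ≤ Δ) : ∀ (h : ℕ) (x : (Fin h → Fin Δ) → α),
    Function.Injective x →
    ∃ e κ, IsLeast (Set.range x) e ∧ (treeMinimum Δ h x).Yields (some e) κ
  | 0, x, _ => by
    refine ⟨x Fin.elim0, 0, ⟨⟨_, rfl⟩, ?_⟩, Comp.yields_pure _⟩
    rintro _ ⟨p, rfl⟩
    rw [Subsingleton.elim p Fin.elim0]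
  | h + 1, x, hx => by
    choose v κ hv hκ using fun i =>
      exists_yields_treeMinimum hΔ h (fun path => x (Fin.cons i path)) (injective_subtree hx i)
    exact (treeMinimum_succ hΔ hx hv fun i => ⟨κ i, hκ i⟩).2.1

/-- The generating functions of the comparison counts in TreeMinimum, in terms of a bound `M` for
the minimum in SampleMinimum on sets with `Δ` elements. -/
theorem mgf_treeMinimum_le (hΔ : 2 ≤ Δ) {z M : ℝ≥0∞} (hz : 1 ≤ z) (hM : 1 ≤ M)
    (H : ∀ (X : Finset α) (e : α), X.card = Δ → e ∈ X → (∀ y ∈ X, e ≤ y) →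
      (sampleMinimum X).mgf z e ≤ M) :
    ∀ (h : ℕ) (x : (Fin h → Fin Δ) → α), Function.Injective x → ∀ e,
      (IsLeast (Set.range x) e → (treeMinimum Δ h x).mgf z e ≤ M ^ h) ∧
      (e ∈ Set.range x → (treeMinimum Δ h x).mgf z e ≤ z ^ Δ * M ^ h) ∧
      (e ∉ Set.range x → (treeMinimum Δ h x).mgf z e ≤ 1)
  | 0, x, _, e => by
    have h1 : (treeMinimum Δ 0 x).mgf z e = 1 := Comp.mgf_pure _ _ _
    rw [h1, pow_zero, mul_one]
    exact ⟨fun _ => le_rfl, fun _ => one_le_pow₀ hz, fun _ => le_rfl⟩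
  | h + 1, x, hx, e => by
    choose v κ hv hκ using fun i =>
      exists_yields_treeMinimum hΔ h (fun path => x (Fin.cons i path)) (injective_subtree hx i)
    obtain ⟨hcard, -, hmgf⟩ := treeMinimum_succ hΔ hx hv fun i => ⟨κ i, hκ i⟩
    have ih := fun i => mgf_treeMinimum_le hΔ hz hM H h (fun path => x (Fin.cons i path))
      (injective_subtree hx i) e
    have hsub : ∀ i, e ∈ Set.range (fun path : Fin h → Fin Δ => x (Fin.cons i path)) →
        e ∈ Set.range x := by
      rintro i ⟨p, rfl⟩
      exact ⟨_, rfl⟩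
    have hvx : ∀ i, v i ∈ Set.range x := by
      intro i
      obtain ⟨p, hp⟩ := (hv i).1
      exact ⟨_, hp⟩
    rw [hmgf]
    -- An element sits in exactly one subtree, and the others contribute factors at most 1.
    have key : e ∈ Set.range x → ∃ i,
        e ∈ Set.range (fun path : Fin h → Fin Δ => x (Fin.cons i path)) ∧
        ∏ j, (treeMinimum Δ h fun path => x (Fin.cons j path)).mgf z e ≤
          (treeMinimum Δ h fun path => x (Fin.cons i path)).mgf z e := by
      rintro ⟨p, rfl⟩
      refine ⟨p 0, ⟨Fin.tail p, by simp⟩, ?_⟩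
      rw [← Finset.mul_prod_erase _ _ (Finset.mem_univ (p 0))]
      refine mul_le_of_le_one_right zero_le (Finset.prod_le_one (fun _ _ => zero_le) fun j hj => ?_)
      refine (ih j).2.2 ?_
      rintro ⟨q, hq⟩
      have := congrFun (hx hq) 0
      rw [Fin.cons_zero] at this
      exact Finset.ne_of_mem_erase hj this
    refine ⟨fun he => ?_, fun he => ?_, fun he => ?_⟩
    · obtain ⟨i, hi, hprod⟩ := key he.1
      have hmin : IsLeast (Set.range fun path : Fin h → Fin Δ => x (Fin.cons i path)) e :=
        ⟨hi, fun y hy => by obtain ⟨p, rfl⟩ := hy; exact he.2 ⟨_, rfl⟩⟩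
      have hvi : v i = e := (hv i).unique hmin
      rw [pow_succ]
      refine mul_le_mul' (hprod.trans ((ih i).1 hmin)) (H _ _ hcard (mem_childMinima.2 ⟨i, hvi⟩) ?_)
      intro y hy
      obtain ⟨j, rfl⟩ := mem_childMinima.1 hy
      exact he.2 (hvx j)
    · obtain ⟨i, hi, hprod⟩ := key he
      -- If `e` is still the minimum of its subtree, all calls so far cost `M ^ h` and the present
      -- one may be its expensive defeat. Otherwise the factor `z ^ Δ` is already included and `e`
      -- is absent from the call at the root.
      by_cases hvi : v i = e
      · calc _ ≤ M ^ h * z ^ Δ :=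
            mul_le_mul' (hprod.trans ((ih i).1 (hvi ▸ hv i)))
              (by simpa only [hcard] using mgf_sampleMinimum_le_pow_card (childMinima v) e hz)
          _ ≤ z ^ Δ * M ^ (h + 1) := by
            rw [mul_comm]
            exact mul_le_mul_right (pow_le_pow_right₀ hM (Nat.le_succ h)) _
      · have hout : e ∉ childMinima v := by
          intro hmem
          obtain ⟨j, hj⟩ := mem_childMinima.1 hmem
          obtain ⟨p, hp⟩ := (hv j).1
          obtain ⟨q, hq⟩ := hi
          have hij := congrFun (hx (hp.trans (hj.trans hq.symm))) 0
          rw [Fin.cons_zero, Fin.cons_zero] at hij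
          exact hvi (hij ▸ hj)
        calc _ ≤ z ^ Δ * M ^ h * 1 :=
            mul_le_mul' (hprod.trans ((ih i).2.1 hi)) (mgf_sampleMinimum_of_notMem hz hout)
          _ ≤ z ^ Δ * M ^ (h + 1) := by
            rw [mul_one]
            exact mul_le_mul_right (pow_le_pow_right₀ hM (Nat.le_succ h)) _
    · refine mul_le_one' (Finset.prod_le_one (fun _ _ => zero_le) fun j _ =>
        (ih j).2.2 fun hj => he (hsub j hj)) (mgf_sampleMinimum_of_notMem hz fun hmem => ?_)
      obtain ⟨j, rfl⟩ := mem_childMinima.1 hmem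
      exact he (hvx j)

end Tree

/-! ### From generating functions to expectations and tails -/

namespace Comp
variable {α β : Type u}

/-- Jensen's inequality, by the tangent to `t ↦ ζ ^ t` at `a`. Negative terms are moved across the
inequality, since subtraction in `ℝ≥0∞` truncates. -/
theorem expectedComparisons_le_of_mgf_le {P : Comp α β} {e : α} {ζ a : ℝ} (hζ : 1 < ζ)
    (ha : 0 ≤ a) (h : mgf P (ENNReal.ofReal ζ) e ≤ ENNReal.ofReal (ζ ^ a)) :
    expectedComparisons P e ≤ ENNReal.ofReal a := by
  have h0 : 0 < ζ := by linarith
  have hlog := Real.log_pos hζ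
  have hd : 0 < ζ ^ a := Real.rpow_pos_of_pos h0 a
  set c := ζ ^ a * Real.log ζ with hc
  have hcpos : 0 < c := mul_pos hd hlog
  have hpt : ∀ m : ℕ, ENNReal.ofReal c * m + ENNReal.ofReal (ζ ^ a) ≤
      ENNReal.ofReal ζ ^ m + ENNReal.ofReal (c * a) := by
    intro m
    have h1 : ζ ^ a * ((m - a) * Real.log ζ + 1) ≤ ζ ^ m := by
      calc ζ ^ a * ((m - a) * Real.log ζ + 1) ≤ ζ ^ a * Real.exp ((m - a) * Real.log ζ) := by
            gcongr
            exact Real.add_one_le_exp _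
        _ = ζ ^ a * ζ ^ ((m : ℝ) - a) := by
            rw [Real.rpow_def_of_pos h0 (m - a), mul_comm (Real.log ζ)]
        _ = ζ ^ m := by rw [← Real.rpow_add h0, add_sub_cancel, Real.rpow_natCast]
    rw [← ENNReal.ofReal_natCast m, ← ENNReal.ofReal_mul hcpos.le, ← ENNReal.ofReal_pow h0.le,
      ← ENNReal.ofReal_add (by positivity) hd.le, ← ENNReal.ofReal_add (by positivity)
      (by positivity)]
    refine ENNReal.ofReal_le_ofReal ?_
    rw [hc]
    linarith
  have hsum : ENNReal.ofReal c * expectedComparisons P e + ENNReal.ofReal (ζ ^ a) ≤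
      mgf P (ENNReal.ofReal ζ) e + ENNReal.ofReal (c * a) := by
    calc _ = ∑' r, law P r * (ENNReal.ofReal c * (r.2 e : ℝ≥0∞) + ENNReal.ofReal (ζ ^ a)) := by
          simp_rw [mul_add]
          rw [ENNReal.tsum_add, ENNReal.tsum_mul_right, PMF.tsum_coe, one_mul, expectedComparisons,
            ← ENNReal.tsum_mul_left]
          simp_rw [mul_left_comm (ENNReal.ofReal c)]
          rfl
      _ ≤ ∑' r, law P r * (ENNReal.ofReal ζ ^ r.2 e + ENNReal.ofReal (c * a)) :=
          ENNReal.tsum_le_tsum fun r => mul_le_mul_right (hpt _) _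
      _ = _ := by
          simp_rw [mul_add]
          rw [ENNReal.tsum_add, ENNReal.tsum_mul_right, PMF.tsum_coe, one_mul, mgf]
  have h2 := hsum.trans (add_le_add_left h _)
  rw [add_comm, ENNReal.add_le_add_iff_left ENNReal.ofReal_ne_top, ENNReal.ofReal_mul hcpos.le]
    at h2
  exact (ENNReal.mul_le_mul_iff_right (ENNReal.ofReal_pos.2 hcpos).ne' ENNReal.ofReal_ne_top).1 h2

/-- Markov's inequality and the union bound. -/
theorem one_sub_le_probComparisons {P : Comp α β} {E : (α → ℕ) → Prop} (s : Finset α)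
    {ζ G T : ℝ} (hζ : 1 ≤ ζ) (hG : 0 ≤ G)
    (h : ∀ e ∈ s, mgf P (ENNReal.ofReal ζ) e ≤ ENNReal.ofReal G)
    (hE : ∀ f, (∀ e ∈ s, (f e : ℝ) ≤ T) → E f) :
    1 - ENNReal.ofReal (s.card * (G * ζ ^ (-T))) ≤ probComparisons P E := by
  classical
  have h0 : 0 < ζ := by linarith
  rw [tsub_le_iff_right]
  calc (1 : ℝ≥0∞) = ∑' r, law P r := (PMF.tsum_coe _).symm
    _ ≤ ∑' r, (Set.indicator {r | E r.2} (law P) r +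
        law P r * ∑ e ∈ s, ENNReal.ofReal ζ ^ r.2 e * ENNReal.ofReal (ζ ^ (-T))) := by
        refine ENNReal.tsum_le_tsum fun r => ?_
        by_cases hr : E r.2
        · rw [Set.indicator_of_mem (by exact hr)]
          exact le_self_add
        · obtain ⟨e, he, hTe⟩ : ∃ e ∈ s, T < r.2 e := by
            by_contra hcon
            push Not at hcon
            exact hr (hE _ hcon)
          have h1 : 1 ≤ ENNReal.ofReal ζ ^ r.2 e * ENNReal.ofReal (ζ ^ (-T)) := by
            rw [← ENNReal.ofReal_pow h0.le, ← ENNReal.ofReal_mul (by positivity),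
              ENNReal.one_le_ofReal, ← Real.rpow_natCast, ← Real.rpow_add h0]
            exact Real.one_le_rpow hζ (by linarith)
          have h2 := h1.trans (Finset.single_le_sum
            (f := fun e => ENNReal.ofReal ζ ^ r.2 e * ENNReal.ofReal (ζ ^ (-T)))
            (fun _ _ => zero_le) he)
          exact (le_mul_of_one_le_right zero_le h2).trans le_add_self
    _ = probComparisons P E + ∑ e ∈ s, mgf P (ENNReal.ofReal ζ) e * ENNReal.ofReal (ζ ^ (-T)) := by
        rw [ENNReal.tsum_add]
        congr 1
        · exact (PMF.toOuterMeasure_apply (law P) {r | E r.2}).symm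
        · simp_rw [Finset.mul_sum]
          rw [Summable.tsum_finsetSum fun _ _ => ENNReal.summable]
          simp_rw [← mul_assoc, ENNReal.tsum_mul_right]
          rfl
    _ ≤ probComparisons P E + ENNReal.ofReal (s.card * (G * ζ ^ (-T))) := by
        gcongr
        rw [ENNReal.ofReal_mul (by positivity), ENNReal.ofReal_natCast, ENNReal.ofReal_mul hG,
          ← nsmul_eq_mul, ← Finset.sum_const]
        exact Finset.sum_le_sum fun e he => mul_le_mul_left (h e he) _

end Comp

/-! ### The choice of parameters -/

/-- For `Δ = 2 ^ y`, the exponent `p ≈ y / log y` keeps the generating function polynomial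
in `Δ`. -/
theorem exists_mgfBase_le {Δ : ℕ} (hΔ : 3 ≤ Δ) : ∃ p j : ℕ, 1 ≤ p ∧
    0 < Real.logb 2 (Real.logb 2 Δ) ∧
    Real.logb 2 Δ ≤ p * Real.logb 2 (Real.logb 2 Δ) ∧
    Real.log Δ ≤ (3 / 2) ^ j * Real.log (512 * p ^ 3) ∧
    mgfBase p * (2 ^ p) ^ (6 * j) ≤ (Δ : ℝ) ^ (564 : ℝ) := by
  have hΔ3 : (3 : ℝ) ≤ Δ := by exact_mod_cast hΔ
  have hΔ0 : (0 : ℝ) < Δ := by linarith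
  set y := Real.logb 2 Δ with hy
  set L := Real.logb 2 y with hL
  have hy1 : 3 / 2 ≤ y := by
    rw [hy, Real.le_logb_iff_rpow_le one_lt_two hΔ0]
    refine le_trans ?_ hΔ3
    refine le_of_pow_le_pow_left₀ two_ne_zero (by norm_num) ?_
    rw [← Real.rpow_natCast, ← Real.rpow_mul (by norm_num)]
    norm_num
  have hy0 : 0 < y := by linarith
  have hL1 : 1 / 2 ≤ L := by
    rw [hL, Real.le_logb_iff_rpow_le one_lt_two hy0]
    refine le_trans ?_ hy1
    refine le_of_pow_le_pow_left₀ two_ne_zero (by norm_num) ?_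
    rw [← Real.rpow_natCast, ← Real.rpow_mul (by norm_num)]
    norm_num
  have h2L : (2 : ℝ) ^ L = y := Real.rpow_logb (by norm_num) (by norm_num) hy0
  have hlog2 := Real.log_two_gt_d9
  have hlog2' := Real.log_two_lt_d9
  have hLy : L ≤ 2 * y := by
    have h1 := Real.add_one_le_exp (Real.log 2 * L)
    rw [← Real.rpow_def_of_pos two_pos, h2L] at h1
    nlinarith
  -- `p * L` has to reach `y` for the tail bound, and `(3/2) ^ j` has to reach `y = 2 ^ L` for the
  -- recursion; the latter holds for `j ≥ 2 * L` because `(3/2) ^ 2 ≥ 2`.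
  obtain ⟨p, hp⟩ : ∃ p, p = ⌈y / L⌉₊ := ⟨_, rfl⟩
  obtain ⟨j, hj⟩ : ∃ j, j = ⌈2 * L⌉₊ := ⟨_, rfl⟩
  have hL0 : 0 < L := by linarith
  have hp1 : 1 ≤ p := by
    rw [hp]
    exact Nat.ceil_pos.2 (by positivity)
  have hp1' : (1 : ℝ) ≤ p := by exact_mod_cast hp1
  have hpL : y ≤ p * L := by
    rw [← div_le_iff₀ hL0, hp]
    exact Nat.le_ceil _
  have hpL' : p * L ≤ 3 * y := by
    have h1 : (p : ℝ) < y / L + 1 := hp ▸ Nat.ceil_lt_add_one (by positivity)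
    have h2 : p * L ≤ (y / L + 1) * L := by gcongr
    rw [add_mul, div_mul_cancel₀ _ hL0.ne'] at h2
    linarith
  have hp6 : (p : ℝ) ≤ 6 * y := by nlinarith
  have hj1 : 2 * L ≤ j := hj ▸ Nat.le_ceil _
  have hj2 : (j : ℝ) ≤ 2 * L + 1 := (hj ▸ Nat.ceil_lt_add_one (by positivity) : (j : ℝ) < _).le
  refine ⟨p, j, hp1, hL0, hpL, ?_, ?_⟩
  · have h1 : y ≤ (3 / 2) ^ j := by
      calc y = 2 ^ L := h2L.symm
        _ ≤ ((3 / 2) ^ (2 : ℝ)) ^ L := by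
          refine Real.rpow_le_rpow (by norm_num) ?_ hL0.le
          norm_num
        _ = (3 / 2) ^ (2 * L) := by rw [← Real.rpow_mul (by norm_num)]
        _ ≤ (3 / 2) ^ (j : ℝ) := Real.rpow_le_rpow_of_exponent_le (by norm_num) hj1
        _ = (3 / 2) ^ j := Real.rpow_natCast _ _
    have h2 : Real.log 2 ≤ Real.log (512 * p ^ 3) := by
      refine Real.log_le_log two_pos ?_
      have : (1 : ℝ) ≤ p ^ 3 := one_le_pow₀ hp1'
      linarith
    have h3 : Real.log Δ = y * Real.log 2 := by
      rw [hy, Real.logb, div_mul_cancel₀]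
      positivity
    rw [h3]
    gcongr
  · have hlogp : Real.logb 2 p ≤ 3 + L := by
      rw [← sub_le_iff_le_add', hL, ← Real.logb_rpow (b := 2) (x := 3) two_pos (by norm_num)]
      rw [sub_le_iff_le_add', ← Real.logb_mul (by positivity) hy0.ne']
      refine Real.logb_le_logb_of_le one_lt_two (by positivity) (hp6.trans ?_)
      have : (2 : ℝ) ^ (3 : ℝ) = 8 := by norm_num
      rw [this]
      linarith
    have hbase : 0 < mgfBase p := by unfold mgfBase; positivity
    rw [← Real.logb_le_logb one_lt_two (by positivity) (by positivity),
      Real.logb_rpow_eq_mul_logb_of_pos hΔ0, ← hy, Real.logb_mul hbase.ne' (by positivity),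
      mgfBase, Real.logb_pow, Real.logb_mul (by norm_num) (by positivity), Real.logb_pow,
      ← pow_mul, Real.logb_pow, Real.logb_self_eq_one one_lt_two]
    have h1024 : Real.logb 2 1024 = 10 := by
      rw [show (1024 : ℝ) = 2 ^ (10 : ℝ) by norm_num, Real.logb_rpow two_pos (by norm_num)]
    rw [h1024]
    push_cast
    have h4 : (p : ℝ) * Real.logb 2 p ≤ p * (3 + L) := by gcongr
    have h5 : (p : ℝ) * j ≤ p * (2 * L + 1) := by gcongr
    -- The exponent is at most `4p(10 + 3(3 + L)) + 6p(2L + 1) = 82p + 24pL`; with `p ≤ 6y` and `pL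
    -- ≤ 3y` this is `492y + 72y = 564y`.
    nlinarith

theorem logb_natCast_pow {Δ h : ℕ} (hΔ : 2 ≤ Δ) : Real.logb Δ ((Δ ^ h : ℕ) : ℝ) = h := by
  have hΔ1 : (1 : ℝ) < Δ := by exact_mod_cast hΔ
  rw [Nat.cast_pow, Real.logb_pow, Real.logb_self_eq_one hΔ1, mul_one]

/-- If the generating functions at `2 ^ p` are polynomial, then all counts in `s` are small with
high probability. -/
theorem one_sub_rpow_le_probComparisons {α β : Type u} {P : Comp α β} {E : (α → ℕ) → Prop}
    {s : Finset α} {Δ h p d : ℕ} {c C M : ℝ} (hΔ : 3 ≤ Δ) (hs : s.card ≤ Δ ^ h) (hC : 0 ≤ C)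
    (hc : 0 < c) (hL : 0 < Real.logb 2 (Real.logb 2 Δ))
    (hp : Real.logb 2 Δ ≤ p * Real.logb 2 (Real.logb 2 Δ)) (hM0 : 0 ≤ M) (hM : M ≤ (Δ : ℝ) ^ C)
    (hmgf : ∀ e ∈ s, P.mgf (ENNReal.ofReal (2 ^ p)) e ≤ ENNReal.ofReal ((2 ^ p) ^ d * M ^ h))
    (hE : ∀ f, (∀ e ∈ s, (f e : ℝ) ≤ d + (C + c + 1) * (Real.logb 2 ((Δ ^ h : ℕ) : ℝ) *
      Real.logb 2 (Real.logb 2 Δ) / Real.logb 2 Δ)) → E f) :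
    1 - ENNReal.ofReal (((Δ ^ h : ℕ) : ℝ) ^ (-c)) ≤ P.probComparisons E := by
  have hΔ3 : (3 : ℝ) ≤ Δ := by exact_mod_cast hΔ
  have hΔ0 : (0 : ℝ) < Δ := by linarith
  have hz1 : (1 : ℝ) ≤ 2 ^ p := one_le_pow₀ one_le_two
  have hy : 0 < Real.logb 2 Δ := Real.logb_pos one_lt_two (by linarith)
  refine le_trans (tsub_le_tsub_left (ENNReal.ofReal_le_ofReal ?_) 1)
    (Comp.one_sub_le_probComparisons s hz1 (by positivity) hmgf hE)
  set y := Real.logb 2 Δ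
  set L := Real.logb 2 y
  have hT : Real.logb 2 ((Δ ^ h : ℕ) : ℝ) * L / y = h * L := by
    rw [Nat.cast_pow, Real.logb_pow]
    field_simp
    rfl
  rw [hT]
  have hn : (0 : ℝ) < Δ ^ h := by positivity
  -- As `2 ^ (p * L) ≥ Δ`, the tail gains `n ^ (C + c + 1)`: the part `C` pays for `M ^ h`, 1 for
  -- the union bound, and `c` remains.
  have hpow : (Δ : ℝ) ^ ((C + c + 1) * h) ≤ ((2 : ℝ) ^ p) ^ ((C + c + 1) * (h * L)) := by
    have h1 : (2 : ℝ) ^ y = Δ := Real.rpow_logb (by norm_num) (by norm_num) hΔ0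
    rw [← h1, ← Real.rpow_natCast 2 p, ← Real.rpow_mul (by norm_num), ← Real.rpow_mul (by norm_num)]
    refine Real.rpow_le_rpow_of_exponent_le one_le_two ?_
    calc y * ((C + c + 1) * h) ≤ p * L * ((C + c + 1) * h) := by gcongr
      _ = _ := by ring
  have hMh : M ^ h ≤ (Δ : ℝ) ^ (C * h) := by
    rw [Real.rpow_mul hΔ0.le, Real.rpow_natCast]
    gcongr
  have hz0 : (0 : ℝ) < 2 ^ p := by positivity
  rw [neg_add, Real.rpow_add hz0, Real.rpow_neg hz0.le, Real.rpow_neg hz0.le, Real.rpow_natCast]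
  -- The summand `d` of the threshold cancels `(2 ^ p) ^ d` exactly, so it needs no constant in
  -- front.
  have hcancel : (2 ^ p) ^ d * M ^ h * (((2 ^ p) ^ d)⁻¹ *
      (((2 : ℝ) ^ p) ^ ((C + c + 1) * (h * L)))⁻¹) =
      M ^ h * (((2 : ℝ) ^ p) ^ ((C + c + 1) * (h * L)))⁻¹ := by
    field_simp
  rw [hcancel]
  calc (s.card : ℝ) * (M ^ h * (((2 : ℝ) ^ p) ^ ((C + c + 1) * (h * L)))⁻¹)
      ≤ (Δ : ℝ) ^ (h : ℝ) * ((Δ : ℝ) ^ (C * h) * ((Δ : ℝ) ^ ((C + c + 1) * h))⁻¹) := by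
        gcongr
        rw [Real.rpow_natCast]
        exact_mod_cast hs
    _ = ((Δ ^ h : ℕ) : ℝ) ^ (-c) := by
        rw [← Real.rpow_neg hΔ0.le, ← Real.rpow_add hΔ0, ← Real.rpow_add hΔ0, Nat.cast_pow,
          ← Real.rpow_natCast, ← Real.rpow_mul hΔ0.le]
        congr 1
        ring

/-! ### Assembly of the expectation and the tail bounds -/

theorem mainTheorem5 :
    (∃ K : ℝ, 0 < K ∧
      ∀ (α : Type u) [LinearOrder α] (Δ h n : ℕ), 2 ≤ Δ → n = Δ ^ h →
      ∀ x : (Fin h → Fin Δ) → α, Function.Injective x →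
        (∀ e ∈ Set.range x, IsLeast (Set.range x) e →
          (treeMinimum Δ h x).expectedComparisons e ≤
            ENNReal.ofReal (K * Real.logb Δ n)) ∧
        (∀ e ∈ Set.range x, ¬ IsLeast (Set.range x) e →
          (treeMinimum Δ h x).expectedComparisons e ≤
            ENNReal.ofReal (Δ + K * Real.logb Δ n))) ∧
    (∀ c : ℝ, 0 < c → ∃ K : ℝ, 0 < K ∧
      ∀ (α : Type u) [LinearOrder α] (Δ h n : ℕ), 3 ≤ Δ → n = Δ ^ h →
      ∀ x : (Fin h → Fin Δ) → α, Function.Injective x →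
        1 - ENNReal.ofReal ((n : ℝ) ^ (-c)) ≤
          (treeMinimum Δ h x).probComparisons (fun f =>
            ∀ e ∈ Set.range x, IsLeast (Set.range x) e →
              (f e : ℝ) ≤ K * (Real.logb 2 n * Real.logb 2 (Real.logb 2 Δ) / Real.logb 2 Δ)) ∧
        1 - ENNReal.ofReal ((n : ℝ) ^ (-c)) ≤
          (treeMinimum Δ h x).probComparisons (fun f =>
            ∀ e ∈ Set.range x, ¬ IsLeast (Set.range x) e →
              (f e : ℝ) ≤
                Δ + K * (Real.logb 2 n * Real.logb 2 (Real.logb 2 Δ) / Real.logb 2 Δ))) := by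
  constructor
  -- Chosen so that `(21/20) ^ K = 2000`: the bound `M ^ h` becomes `(21/20) ^ (K * h)` and its
  -- exponent bounds the expectation.
  · set K := Real.log 2000 / Real.log (21 / 20) with hK
    have hlog : 0 < Real.log (21 / 20) := Real.log_pos (by norm_num)
    have hK0 : 0 < K := div_pos (Real.log_pos (by norm_num)) hlog
    have hpow : (21 / 20 : ℝ) ^ K = 2000 := by
      rw [Real.rpow_def_of_pos (by norm_num), hK, mul_div_cancel₀ _ hlog.ne',
        Real.exp_log (by norm_num)]
    refine ⟨K, hK0, ?_⟩
    rintro α _ Δ h n hΔ rfl x hx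
    have hmgf := mgf_treeMinimum_le hΔ (z := ENNReal.ofReal (21 / 20))
      (M := ENNReal.ofReal 2000) (ENNReal.one_le_ofReal.2 (by norm_num))
      (ENNReal.one_le_ofReal.2 (by norm_num))
      (fun X e _ he hmin => mgf_sampleMinimum_le_const X e he hmin) h x hx
    have hKh : (21 / 20 : ℝ) ^ (K * h) = 2000 ^ h := by
      rw [Real.rpow_mul (by norm_num), hpow, Real.rpow_natCast]
    rw [logb_natCast_pow hΔ]
    refine ⟨fun e _ hleast => ?_, fun e he _ => ?_⟩
    · refine Comp.expectedComparisons_le_of_mgf_le (by norm_num : (1 : ℝ) < 21 / 20)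
        (by positivity) (((hmgf e).1 hleast).trans_eq ?_)
      rw [hKh, ENNReal.ofReal_pow (by norm_num)]
    · refine Comp.expectedComparisons_le_of_mgf_le (by norm_num : (1 : ℝ) < 21 / 20)
        (by positivity) (((hmgf e).2.1 he).trans_eq ?_)
      rw [Real.rpow_add (by norm_num), hKh, Real.rpow_natCast, ENNReal.ofReal_mul (by positivity),
        ENNReal.ofReal_pow (by norm_num), ENNReal.ofReal_pow (by norm_num)]
  · intro c hc
    refine ⟨564 + c + 1, by positivity, ?_⟩
    rintro α _ Δ h n hΔ rfl x hx
    obtain ⟨p, j, hp1, hL, hpL, hlog, hbound⟩ := exists_mgfBase_le hΔ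
    set M := mgfBase p * (2 ^ p) ^ (6 * j) with hM
    have hp0 : (1 : ℝ) ≤ p := by exact_mod_cast hp1
    have hz1 : (1 : ℝ) ≤ 2 ^ p := one_le_pow₀ one_le_two
    have hM1 : 1 ≤ M := by
      have h1 : 1 ≤ mgfBase p := by
        refine one_le_pow₀ ?_
        have : (1 : ℝ) ≤ p ^ 3 := one_le_pow₀ hp0
        linarith
      exact one_le_mul_of_one_le_of_one_le h1 (one_le_pow₀ hz1)
    have hmgf := mgf_treeMinimum_le (by omega : 2 ≤ Δ) (z := ENNReal.ofReal (2 ^ p))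
      (M := ENNReal.ofReal M) (ENNReal.one_le_ofReal.2 hz1) (ENNReal.one_le_ofReal.2 hM1)
      (fun X e hX he hmin => mgf_sampleMinimum_le_growth hp1 j X e he hmin (by rwa [hX])) h x hx
    have hM0 : 0 ≤ M := by linarith
    constructor
    · obtain ⟨e₀, -, he₀, -⟩ := exists_yields_treeMinimum (by omega : 2 ≤ Δ) h x hx
      -- For the minimum alone no factor `z ^ Δ` occurs, hence `d = 0`; the other elements are
      -- treated below with `d = Δ` and a union bound over all leaves.
      refine one_sub_rpow_le_probComparisons (s := {e₀}) (p := p) (d := 0) (C := 564) (M := M) hΔ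
        ?_ (by norm_num) hc hL hpL hM0 hbound ?_ ?_
      · rw [Finset.card_singleton]
        exact Nat.one_le_pow _ _ (by omega)
      · intro e he
        rw [Finset.mem_singleton.1 he, pow_zero, one_mul, ENNReal.ofReal_pow hM0]
        exact (hmgf e₀).1 he₀
      · intro f hf e _ hleast
        rw [hleast.unique he₀]
        simpa using hf e₀ (Finset.mem_singleton_self _)
    · refine one_sub_rpow_le_probComparisons (s := Finset.univ.image x) (p := p) (d := Δ)
        (C := 564) (M := M) hΔ ?_ (by norm_num) hc hL hpL hM0 hbound ?_ ?_
      · refine Finset.card_image_le.trans ?_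
        simp
      · intro e he
        rw [ENNReal.ofReal_mul (by positivity), ENNReal.ofReal_pow hM0,
          ENNReal.ofReal_pow (by positivity : (0 : ℝ) ≤ 2 ^ p) Δ]
        exact (hmgf e).2.1 (by simpa using he)
      · intro f hf e he _
        exact hf e (by simpa using he)
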